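/- Let $p$ be a prime and let $\mathcal{F}$ be a (not necessarily saturated) fusion system over a finite $p$-group $S$. For $i=1,2$ let $\mathcal{F}_i$ be a saturated subsystem of $\mathcal{F}$ over a subgroup $S_i\leq S$. We say that $\mathcal{F}_1$ and $\mathcal{F}_2$ \emph{centralize each other} if $\mathcal{F}_1\subseteq C_{\mathcal{F}}(S_2)$ and $\mathcal{F}_2\subseteq C_{\mathcal{F}}(S_1)$; here, for $X\leq S$, $C_{\mathcal{F}}(X)$ is the fusion system over $C_S(X)$ whose morphisms $P\to Q$ are the $\varphi\in\operatorname{Hom}_{\mathcal{F}}(P,Q)$ which extend to some $\hat\varphi\in\operatorname{Hom}_{\mathcal{F}}(PX,QX)$ with $\hat\varphi|_X=\mathrm{id}_X$. Let $\mathcal{F}_1\times\mathcal{F}_2$ be the direct product, i.e. the fusion system over $S_1\times S_2$ generated by the maps $\varphi_1\times\varphi_2$ with $\varphi_i$ a morphism of $\mathcal{F}_i$, and let $\hat{\mathcal{F}}_i$ be the canonical image of $\mathcal{F}_i$ in it. A group homomorphism $\alpha\colon R\to R'$ \emph{induces a morphism} from a fusion system $\mathcal{E}$ over $R$ to a fusion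 system $\mathcal{E}'$ over $R'$ if for every $\varphi\in\operatorname{Hom}_{\mathcal{E}}(P,Q)$ there is a (necessarily unique) $\psi\in\operatorname{Hom}_{\mathcal{E}'}(\alpha(P),\alpha(Q))$ with $\psi\circ\alpha|_P=\alpha|_Q\circ\varphi$; for a subsystem $\mathcal{E}_0$ of $\mathcal{E}$ let $\mathcal{E}_0^{\alpha}$ be its image, consisting of the maps $\psi$ so obtained from morphisms $\varphi$ of $\mathcal{E}_0$. It \emph{induces an epimorphism} if, moreover, $\alpha$ is surjective and the induced map $\operatorname{Hom}_{\mathcal{E}}(P,Q)\to\operatorname{Hom}_{\mathcal{E}'}(\alpha(P),\alpha(Q))$ is surjective for all $P,Q\leq R$ containing $\ker(\alpha)$ (so that in particular $\mathcal{E}^{\alpha}=\mathcal{E}'$). A fusion system $\mathcal{D}$ over $T$ containing $\mathcal{F}_1$ and $\mathcal{F}_2$ as subsystems is a \emph{central product} of $\mathcal{F}_1$ and $\mathcal{F}_2$ if $S_1\cap S_2\leq Z(\mathcal{F}_i)$ for $i=1,2$, and the map $\alpha\colon S_1\times S_2\to T$, $(x_1,x_2)\mapsto x_1x_2$, is a group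 homomorphism inducing an epimorphism from $\mathcal{F}_1\times\mathcal{F}_2$ to $\mathcal{D}$ with $\hat{\mathcal{F}}_i^{\alpha}=\mathcal{F}_i$ for $i=1,2$. Here the centre $Z(\mathcal{F}_i)$ is the largest subgroup $Z$ of $S_i$ with $C_{\mathcal{F}_i}(Z)=\mathcal{F}_i$. Then the following two conditions are equivalent: (i) $\mathcal{F}_1$ and $\mathcal{F}_2$ centralize each other. (ii) $\mathcal{F}$ contains a subsystem $\mathcal{D}$ which is a central product of $\mathcal{F}_1$ and $\mathcal{F}_2$. If these conditions hold, let $\mathcal{F}_1*\mathcal{F}_2$ be the fusion system over $S_1S_2$ generated by all $\psi\in\operatorname{Hom}_{\mathcal{F}}(P_1P_2,S_1S_2)$ with $P_i\leq S_i$ and $\psi|_{P_i}\in\operatorname{Hom}_{\mathcal{F}_i}(P_i,S_i)$ for $i=1,2$. Then $\mathcal{F}_1*\mathcal{F}_2$ is a subsystem of $\mathcal{F}$ and a central product of $\mathcal{F}_1$ and $\mathcal{F}_2$, and it is saturated. -/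

import Mathlib

/-- A fusion system over a subgroup `base` of an ambient group `G`. The objects are the subgroups
of `base`, the morphism sets are sets of injective group homomorphisms which contain all the
homomorphisms induced by conjugation in `base`, they are closed under composition, and every
morphism is the composite of an isomorphism of the category (an invertible homomorphism which lies
in the category together with its inverse) with an inclusion. Identities and inclusions are
conjugations by `1`. -/
@[ext]
structure FusionSystem (G : Type*) [Group G] where
  base : Subgroup G
  Hom : (P Q : Subgroup G) → Set (P →* Q)
  dom_le : ∀ {P Q : Subgroup G} {φ : P →* Q}, φ ∈ Hom P Q → P ≤ base
  cod_le : ∀ {P Q : Subgroup G} {φ : P →* Q}, φ ∈ Hom P Q → Q ≤ base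
  injective : ∀ {P Q : Subgroup G} {φ : P →* Q}, φ ∈ Hom P Q → Function.Injective φ
  conj_mem : ∀ {P Q : Subgroup G} (φ : P →* Q) (s : G), P ≤ base → Q ≤ base → s ∈ base →
    (∀ x : P, (φ x : G) = s * x * s⁻¹) → φ ∈ Hom P Q
  comp_mem : ∀ {P Q R : Subgroup G} {φ : P →* Q} {ψ : Q →* R},
    φ ∈ Hom P Q → ψ ∈ Hom Q R → ψ.comp φ ∈ Hom P R
  factor : ∀ {P Q : Subgroup G} {φ : P →* Q}, φ ∈ Hom P Q →
    ∃ (R : Subgroup G) (hR : R ≤ Q) (e : P ≃* R),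
      e.toMonoidHom ∈ Hom P R ∧ e.symm.toMonoidHom ∈ Hom R P ∧
        φ = (Subgroup.inclusion hR).comp e.toMonoidHom

namespace FusionSystem

/-- `ψ` extends `φ`, where both are regarded as maps with values in `G`. -/
def Extends {G : Type*} [Group G] {P Q P' Q' : Subgroup G} (ψ : P' →* Q') (φ : P →* Q) : Prop :=
  ∃ h : P ≤ P', ∀ x : P, (ψ (Subgroup.inclusion h x) : G) = φ x

/-- `E ≤ F` means that `E` is a subsystem of `F` (over `E.base`). -/
instance {G : Type*} [Group G] : LE (FusionSystem G) where
  le E F := E.base ≤ F.base ∧ ∀ P Q : Subgroup G, E.Hom P Q ⊆ F.Hom P Q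

/-! ### Elementary helper facts -/

section Helpers

variable {G : Type*} [Group G] (F : FusionSystem G)

theorem inclusion_mem {P Q : Subgroup G} (h : P ≤ Q) (hQ : Q ≤ F.base) :
    Subgroup.inclusion h ∈ F.Hom P Q :=
  F.conj_mem _ 1 (h.trans hQ) hQ F.base.one_mem (by intro x; simp)

theorem mem_of_eq {P Q P' Q' : Subgroup G} {φ : P →* Q} (hφ : φ ∈ F.Hom P Q) (hP : P = P')
    (hQ : Q = Q') (ψ : P' →* Q')
    (h : ∀ (x : G) (hx : x ∈ P) (hx' : x ∈ P'), (ψ ⟨x, hx'⟩ : G) = φ ⟨x, hx⟩) :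
    ψ ∈ F.Hom P' Q' := by
  subst hP hQ
  have : ψ = φ := by
    ext x
    exact h x x.2 x.2
  rwa [this]

theorem exists_equiv_of_mem {P Q : Subgroup G} {φ : P →* Q} (hφ : φ ∈ F.Hom P Q)
    (R : Subgroup G) (e : P ≃* R) (he : ∀ x, (e x : G) = φ x) :
    e.toMonoidHom ∈ F.Hom P R ∧ e.symm.toMonoidHom ∈ F.Hom R P := by
  obtain ⟨R', hR', e', h1, h2, h3⟩ := F.factor hφ
  have hee : ∀ x, (e x : G) = e' x := by
    intro x; rw [he, h3]; rfl
  have hRR : R' = R := by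
    ext y
    constructor
    · intro hy
      have := hee (e'.symm ⟨y, hy⟩)
      simp only [MulEquiv.apply_symm_apply] at this
      rw [← this]; exact (e _).2
    · intro hy
      have := hee (e.symm ⟨y, hy⟩)
      simp only [MulEquiv.apply_symm_apply] at this
      rw [this]; exact (e' _).2
  subst hRR
  have : e = e' := by
    ext x; exact hee x
  subst this
  exact ⟨h1, h2⟩

/-- An injective homomorphism, with its codomain restricted to its image in `G`. -/
theorem exists_image {P Q : Subgroup G} (φ : P →* Q) (hφ : Function.Injective φ) :
    ∃ (R : Subgroup G) (_ : R ≤ Q) (e : P ≃* R), ∀ x, (e x : G) = φ x := by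
  have hinj : Function.Injective (Q.subtype.comp φ) :=
    Q.subtype_injective.comp hφ
  refine ⟨(Q.subtype.comp φ).range, ?_, MonoidHom.ofInjective hinj, fun x => rfl⟩
  rintro _ ⟨x, rfl⟩
  exact (φ x).2

theorem restrict_mem {P Q P' Q' : Subgroup G} {ψ : P' →* Q'} (hψ : ψ ∈ F.Hom P' Q')
    (hQ : Q ≤ F.base) (φ : P →* Q) (h : Extends ψ φ) : φ ∈ F.Hom P Q := by
  obtain ⟨hP, h⟩ := h
  have h1 := F.comp_mem (F.inclusion_mem hP (F.dom_le hψ)) hψ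
  have hinj : Function.Injective φ := by
    intro x y hxy
    apply F.injective h1
    apply Subtype.ext
    have := (h x).trans ((congrArg Subtype.val hxy).trans (h y).symm)
    exact this
  obtain ⟨R, hR, e, he⟩ := exists_image φ hinj
  have h2 := F.exists_equiv_of_mem h1 R e (fun x => (he x).trans (h x).symm)
  have h3 := F.comp_mem h2.1 (F.inclusion_mem hR hQ)
  refine F.mem_of_eq h3 rfl rfl φ ?_
  intro x hx _
  exact (he ⟨x, hx⟩).symm

end Helpers

/-! ### Saturation -/

section Saturation

variable {G : Type*} [Group G]

/-- `Q` is an `F`-conjugate of `P`: there is an isomorphism from `P` to `Q` in `F`. -/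
def IsConj (F : FusionSystem G) (P Q : Subgroup G) : Prop :=
  ∃ e : P ≃* Q, e.toMonoidHom ∈ F.Hom P Q

/-- `|N_S(P)| ≥ |N_S(Q)|` for every `F`-conjugate `Q` of `P`, where `S = F.base`. -/
def FullyNormalized (F : FusionSystem G) (P : Subgroup G) : Prop :=
  ∀ Q, F.IsConj P Q →
    Nat.card ↥(F.base ⊓ Subgroup.normalizer (Q : Set G)) ≤
      Nat.card ↥(F.base ⊓ Subgroup.normalizer (P : Set G))

/-- `|C_S(P)| ≥ |C_S(Q)|` for every `F`-conjugate `Q` of `P`, where `S = F.base`. -/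
def FullyCentralized (F : FusionSystem G) (P : Subgroup G) : Prop :=
  ∀ Q, F.IsConj P Q →
    Nat.card ↥(F.base ⊓ Subgroup.centralizer (Q : Set G)) ≤
      Nat.card ↥(F.base ⊓ Subgroup.centralizer (P : Set G))

/-- The group `Aut_F(P)`. -/
def aut (F : FusionSystem G) (P : Subgroup G) (hP : P ≤ F.base) : Subgroup (MulAut P) where
  carrier := {e | e.toMonoidHom ∈ F.Hom P P}
  one_mem' := F.conj_mem _ 1 hP hP F.base.one_mem (by intro x; simp)
  mul_mem' := fun ha hb => F.comp_mem hb ha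
  inv_mem' := fun {e} he => (F.exists_equiv_of_mem he P e (fun _ => rfl)).2

/-- The group `Aut_S(P)` of automorphisms of `P` induced by conjugation with elements of
`N_S(P)`. -/
def autBase (S P : Subgroup G) : Subgroup (MulAut P) :=
  (S.subgroupOf (Subgroup.normalizer (P : Set G))).map P.normalizerMonoidHom

/-- For an isomorphism `φ : P ≃* Q`, the group `N_φ` of all `g ∈ N_S(P)` such that
the automorphism `φ ∘ c_g ∘ φ⁻¹` of `Q` lies in `Aut_S(Q)`. -/
def extensionDomain (S : Subgroup G) {P Q : Subgroup G} (φ : P ≃* Q) : Subgroup G :=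
  S ⊓ (((autBase S Q).comap (MulAut.congr φ).toMonoidHom).comap P.normalizerMonoidHom).map
    (Subgroup.normalizer (P : Set G)).subtype

/-- Saturation of a fusion system (over a finite `p`-group), in the form of the Sylow axiom and
the extension axiom. -/
structure IsSaturated (p : ℕ) (F : FusionSystem G) : Prop where
  sylow : ∀ (P : Subgroup G) (hP : P ≤ F.base), F.FullyNormalized P →
    F.FullyCentralized P ∧
      ∃ A : Sylow p (F.aut P hP), (A : Subgroup (F.aut P hP)) =
        (autBase F.base P).subgroupOf (F.aut P hP)
  extension : ∀ (P Q : Subgroup G) (φ : P ≃* Q), φ.toMonoidHom ∈ F.Hom P Q →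
    F.FullyCentralized Q →
      ∃ ψ ∈ F.Hom (extensionDomain F.base φ) F.base, Extends ψ φ.toMonoidHom

end Saturation

/-! ### Centralizers and the centre -/

section Centralizers

variable {G : Type*} [Group G]

/-- The centralizer `C_F(X)` of a subgroup `X` of `S = F.base`: the fusion system over `C_S(X)`
whose morphisms `P → Q` are those morphisms of `F` between subgroups of `C_S(X)` which extend to a
morphism `P X → Q X` of `F` that is the identity on `X`. (Here `P ⊔ X = P X`.) -/
def centralizer (F : FusionSystem G) (X : Subgroup G) (hX : X ≤ F.base) : FusionSystem G where
  base := F.base ⊓ Subgroup.centralizer (X : Set G)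
  Hom P Q := {φ | P ≤ F.base ⊓ Subgroup.centralizer (X : Set G) ∧
    Q ≤ F.base ⊓ Subgroup.centralizer (X : Set G) ∧ φ ∈ F.Hom P Q ∧
    ∃ ψ ∈ F.Hom (P ⊔ X) (Q ⊔ X), Extends ψ φ ∧ Extends ψ (MonoidHom.id X)}
  dom_le h := h.1
  cod_le h := h.2.1
  injective h := F.injective h.2.2.1
  conj_mem := by
    intro P Q φ s hP hQ hs h
    have hsX : ∀ x ∈ X, s * x * s⁻¹ = x := by
      intro x hx
      have := Subgroup.mem_centralizer_iff.1 hs.2 x hx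
      rw [← this]; simp
    have hPX : P ⊔ X ≤ (Q ⊔ X).comap (MulAut.conj s).toMonoidHom := by
      refine sup_le ?_ ?_
      · intro x hx
        have := h ⟨x, hx⟩
        have h2 : s * x * s⁻¹ ∈ Q := by rw [← this]; exact (φ _).2
        exact Subgroup.mem_sup_left h2
      · intro x hx
        have h2 : s * x * s⁻¹ ∈ X := by rw [hsX x hx]; exact hx
        exact Subgroup.mem_sup_right h2
    refine ⟨hP, hQ, F.conj_mem φ s (hP.trans inf_le_left) (hQ.trans inf_le_left) hs.1 h, ?_⟩
    let ψ : ↥(P ⊔ X) →* ↥(Q ⊔ X) :=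
      ((MulAut.conj s).toMonoidHom.comp (P ⊔ X).subtype).codRestrict (Q ⊔ X)
        (fun x => hPX x.2)
    have hψ : ∀ x, (ψ x : G) = s * x * s⁻¹ := fun x => rfl
    refine ⟨ψ, F.conj_mem ψ s (sup_le (hP.trans inf_le_left) hX)
      (sup_le (hQ.trans inf_le_left) hX) hs.1 hψ, ⟨le_sup_left, ?_⟩, ⟨le_sup_right, ?_⟩⟩
    · intro x
      rw [h, hψ]
      rfl
    · intro x
      rw [hψ]; exact hsX x x.2
  comp_mem := by
    rintro P Q R φ χ ⟨hP, hQ, hφ, φ', hφ', ⟨a1, h1⟩, ⟨a2, h2⟩⟩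
      ⟨_, hR, hχ, χ', hχ', ⟨a3, h3⟩, ⟨a4, h4⟩⟩
    refine ⟨hP, hR, F.comp_mem hφ hχ, χ'.comp φ', F.comp_mem hφ' hχ', ⟨a1, ?_⟩, ⟨a2, ?_⟩⟩
    · intro x
      have e : φ' (Subgroup.inclusion a1 x) = Subgroup.inclusion a3 (φ x) := Subtype.ext (h1 x)
      simp only [MonoidHom.comp_apply]
      rw [e, h3]
    · intro x
      have e : φ' (Subgroup.inclusion a2 x) = Subgroup.inclusion a4 x := Subtype.ext (h2 x)
      simp only [MonoidHom.comp_apply]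
      rw [e, h4]
  factor := by
    rintro P Q φ ⟨hP, hQ, hφ, φ', hφ', ⟨a1, h1⟩, ⟨a2, h2⟩⟩
    obtain ⟨R, hR, e, he, hes, hc⟩ := F.factor hφ
    obtain ⟨R', hR', e', he', hes', hc'⟩ := F.factor hφ'
    have v : ∀ x, (e x : G) = φ x := by intro x; rw [hc]; rfl
    have v' : ∀ x, (e' x : G) = φ' x := by intro x; rw [hc']; rfl
    have eP : ∀ x : P, (e' (Subgroup.inclusion a1 x) : G) = e x := by
      intro x; rw [v', h1, v]
    have eX : ∀ x : X, (e' (Subgroup.inclusion a2 x) : G) = x := by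
      intro x; rw [v', h2]; rfl
    have hRR : R' = R ⊔ X := by
      apply le_antisymm
      · have key : P ⊔ X ≤ ((R ⊔ X).comap (R'.subtype.comp e'.toMonoidHom)).map
            (P ⊔ X).subtype := by
          refine sup_le ?_ ?_
          · intro x hx
            refine ⟨⟨x, a1 hx⟩, ?_, rfl⟩
            have := eP ⟨x, hx⟩
            have h3 : (e' (Subgroup.inclusion a1 ⟨x, hx⟩) : G) ∈ R ⊔ X := by
              rw [this]; exact Subgroup.mem_sup_left (e ⟨x, hx⟩).2
            exact h3
          · intro x hx
            refine ⟨⟨x, a2 hx⟩, ?_, rfl⟩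
            have := eX ⟨x, hx⟩
            have h3 : (e' (Subgroup.inclusion a2 ⟨x, hx⟩) : G) ∈ R ⊔ X := by
              rw [this]; exact Subgroup.mem_sup_right hx
            exact h3
        intro y hy
        obtain ⟨z, hz, hz'⟩ := key (e'.symm ⟨y, hy⟩).2
        have hz2 : z = e'.symm ⟨y, hy⟩ := Subtype.ext hz'
        subst hz2
        simpa using hz
      · refine sup_le ?_ ?_
        · intro y hy
          have := eP (e.symm ⟨y, hy⟩)
          simp only [MulEquiv.apply_symm_apply] at this
          rw [← this]; exact (e' _).2
        · intro y hy
          have := eX ⟨y, hy⟩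
          simp only at this
          rw [← this]; exact (e' _).2
    subst hRR
    have hRb : R ≤ F.base ⊓ Subgroup.centralizer (X : Set G) := hR.trans hQ
    refine ⟨R, hR, e, ⟨hP, hRb, he, e'.toMonoidHom, he', ⟨a1, eP⟩, ⟨a2, eX⟩⟩,
      ⟨hRb, hP, hes, e'.symm.toMonoidHom, hes', ⟨le_sup_left, ?_⟩, ⟨le_sup_right, ?_⟩⟩, hc⟩
    · intro y
      have : e'.symm (Subgroup.inclusion le_sup_left y) = Subgroup.inclusion a1 (e.symm y) := by
        rw [MulEquiv.symm_apply_eq]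
        apply Subtype.ext
        rw [eP]; simp
      exact congrArg Subtype.val this
    · intro y
      have : e'.symm (Subgroup.inclusion le_sup_right y) = Subgroup.inclusion a2 y := by
        rw [MulEquiv.symm_apply_eq]
        apply Subtype.ext
        rw [eX]; rfl
      exact congrArg Subtype.val this

/-- `Q` is central in `F`, i.e. `C_F(Q) = F`. -/
def IsCentral (F : FusionSystem G) (Q : Subgroup G) : Prop :=
  ∃ h : Q ≤ F.base, F.centralizer Q h = F

/-- The centre `Z(F)`, the largest central subgroup. -/
def center (F : FusionSystem G) : Subgroup G :=
  sSup {Q | F.IsCentral Q}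

theorem isCentral_iff (F : FusionSystem G) (Q : Subgroup G) :
    F.IsCentral Q ↔ Q ≤ F.base ∧ F.base ≤ Subgroup.centralizer (Q : Set G) ∧
      ∀ (P R : Subgroup G), ∀ φ ∈ F.Hom P R,
        ∃ ψ ∈ F.Hom (P ⊔ Q) (R ⊔ Q), Extends ψ φ ∧ Extends ψ (MonoidHom.id Q) := by
  constructor
  · rintro ⟨h, he⟩
    refine ⟨h, ?_, fun P R φ hφ => ?_⟩
    · have : (F.centralizer Q h).base = F.base := by rw [he]
      exact inf_eq_left.1 this
    · rw [← he] at hφ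
      exact hφ.2.2.2
  · rintro ⟨h, hc, hex⟩
    refine ⟨h, FusionSystem.ext (inf_eq_left.2 hc) ?_⟩
    funext P R
    ext φ
    have hb : F.base ⊓ Subgroup.centralizer (Q : Set G) = F.base := inf_eq_left.2 hc
    constructor
    · exact fun hφ => hφ.2.2.1
    · exact fun hφ => ⟨hb.symm ▸ F.dom_le hφ, hb.symm ▸ F.cod_le hφ, hφ, hex P R φ hφ⟩

theorem IsCentral.bot (F : FusionSystem G) : F.IsCentral ⊥ := by
  rw [isCentral_iff]
  refine ⟨bot_le, ?_, fun P R φ hφ => ?_⟩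
  · intro x _
    rw [Subgroup.mem_centralizer_iff]
    rintro y hy
    rw [Subgroup.mem_bot.1 hy]; simp
  · refine ⟨(Subgroup.inclusion le_sup_left).comp
        (φ.comp (Subgroup.inclusion (sup_bot_eq P).le)), ?_, ⟨le_sup_left, fun x => rfl⟩,
        ⟨le_sup_right, fun x => ?_⟩⟩
    · exact F.comp_mem (F.comp_mem (F.inclusion_mem _ (F.dom_le hφ)) hφ)
        (F.inclusion_mem _ (sup_le (F.cod_le hφ) bot_le))
    · have hx : x = 1 := Subsingleton.elim _ _
      subst hx; simp

theorem IsCentral.sup {F : FusionSystem G} {Q Q' : Subgroup G} (h : F.IsCentral Q)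
    (h' : F.IsCentral Q') : F.IsCentral (Q ⊔ Q') := by
  rw [isCentral_iff] at *
  obtain ⟨a, b, c⟩ := h
  obtain ⟨a', b', c'⟩ := h'
  refine ⟨sup_le a a', ?_, fun P R φ hφ => ?_⟩
  · rw [Subgroup.le_centralizer_iff] at *
    exact sup_le b b'
  · obtain ⟨ψ, hψ, ⟨i1, k1⟩, ⟨i2, k2⟩⟩ := c P R φ hφ
    obtain ⟨χ, hχ, ⟨i3, k3⟩, ⟨i4, k4⟩⟩ := c' _ _ ψ hψ
    let θ : ↥(P ⊔ (Q ⊔ Q')) →* ↥(R ⊔ (Q ⊔ Q')) :=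
      (Subgroup.inclusion (sup_assoc R Q Q').le).comp
        (χ.comp (Subgroup.inclusion (sup_assoc P Q Q').ge))
    have hθ : ∀ (x : G) (hx : x ∈ P ⊔ (Q ⊔ Q')) (hx' : x ∈ P ⊔ Q ⊔ Q'),
        (θ ⟨x, hx⟩ : G) = χ ⟨x, hx'⟩ := fun _ _ _ => rfl
    refine ⟨θ, F.mem_of_eq hχ (sup_assoc _ _ _) (sup_assoc _ _ _) θ (fun x hx hx' => rfl),
      ⟨le_sup_left, fun x => ?_⟩, ⟨le_sup_right, fun x => ?_⟩⟩
    · exact (k3 (Subgroup.inclusion i1 x)).trans (k1 x)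
    · have hle : Q ⊔ Q' ≤ P ⊔ (Q ⊔ Q') := le_sup_right
      have key : Q ⊔ Q' ≤ (((Subgroup.subtype _).comp θ).eqLocus (Subgroup.subtype _)).map
          (P ⊔ (Q ⊔ Q')).subtype := by
        refine sup_le ?_ ?_
        · intro y hy
          exact ⟨⟨y, hle (Subgroup.mem_sup_left hy)⟩,
            (k3 (Subgroup.inclusion i2 ⟨y, hy⟩)).trans (k2 ⟨y, hy⟩), rfl⟩
        · intro y hy
          exact ⟨⟨y, hle (Subgroup.mem_sup_right hy)⟩, k4 ⟨y, hy⟩, rfl⟩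
      obtain ⟨y, hy, hyx⟩ := key x.2
      have : y = Subgroup.inclusion hle x := Subtype.ext hyx
      subst this
      exact hy

/-- The centre is indeed central, hence the largest central subgroup. -/
theorem isCentral_center (F : FusionSystem G) [Finite F.base] : F.IsCentral F.center := by
  have hfin : {Q | F.IsCentral Q}.Finite := by
    refine Set.Finite.subset (s := {Q | Q ≤ F.base}) ?_ (fun Q hQ => hQ.1)
    have : Finite (Set.Iic F.base) := Finite.of_injective
      (fun Q : Set.Iic F.base => (Q : Subgroup G).subgroupOf F.base) (by
        rintro ⟨A, hA⟩ ⟨B, hB⟩ h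
        have := (Subgroup.subgroupOf_inj (K := F.base)).1 h
        rw [inf_eq_left.2 hA, inf_eq_left.2 hB] at this
        exact Subtype.ext this)
    exact Set.toFinite (Set.Iic F.base)
  have : ∀ s : Finset (Subgroup G), (∀ Q ∈ s, F.IsCentral Q) → F.IsCentral (s.sup id) := by
    intro s hs
    exact Finset.sup_induction (IsCentral.bot F) (fun _ h _ h' => h.sup h') hs
  have h2 := this hfin.toFinset (by intro Q hQ; simpa using hQ)
  rwa [Finset.sup_id_eq_sSup, Set.Finite.coe_toFinset] at h2

/-- The subsystems `F₁` and `F₂` of `F` centralize each other: `F₁ ⊆ C_F(S₂)` and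
`F₂ ⊆ C_F(S₁)`. -/
def CentralizeEachOther (F F₁ F₂ : FusionSystem G) (h₁ : F₁ ≤ F) (h₂ : F₂ ≤ F) : Prop :=
  F₁ ≤ F.centralizer F₂.base h₂.1 ∧ F₂ ≤ F.centralizer F₁.base h₁.1

end Centralizers

/-! ### Generated fusion systems -/

section Generate

variable {G : Type*} [Group G]

/-- The smallest fusion system over `R` which contains a given collection of injective
homomorphisms between subgroups of `R`: the intersection of all such fusion systems. If the given
homomorphisms are morphisms of some `F`, this is also the smallest subsystem of `F` over `R`
containing them. -/
def generate (R : Subgroup G) (C : (P Q : Subgroup G) → Set (P →* Q)) : FusionSystem G where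
  base := R
  Hom P Q := {φ | P ≤ R ∧ Q ≤ R ∧ Function.Injective φ ∧
    ∀ E : FusionSystem G, E.base = R → (∀ P' Q', C P' Q' ⊆ E.Hom P' Q') → φ ∈ E.Hom P Q}
  dom_le h := h.1
  cod_le h := h.2.1
  injective h := h.2.2.1
  conj_mem := by
    intro P Q φ s hP hQ hs h
    refine ⟨hP, hQ, ?_, fun E hE _ => ?_⟩
    · intro x y hxy
      have := congrArg Subtype.val hxy
      rw [h, h] at this
      exact Subtype.ext (by simpa using this)
    · subst hE
      exact E.conj_mem φ s hP hQ hs h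
  comp_mem := by
    rintro P Q T φ ψ ⟨h1, h2, h3, h4⟩ ⟨k1, k2, k3, k4⟩
    exact ⟨h1, k2, k3.comp h3, fun E hE hC => E.comp_mem (h4 E hE hC) (k4 E hE hC)⟩
  factor := by
    rintro P Q φ ⟨h1, h2, h3, h4⟩
    obtain ⟨T, hT, e, he⟩ := exists_image φ h3
    refine ⟨T, hT, e, ⟨h1, hT.trans h2, e.injective, fun E hE hC => ?_⟩,
      ⟨hT.trans h2, h1, e.symm.injective, fun E hE hC => ?_⟩, ?_⟩
    · exact (E.exists_equiv_of_mem (h4 E hE hC) T e he).1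
    · exact (E.exists_equiv_of_mem (h4 E hE hC) T e he).2
    · ext x; exact (he x).symm

end Generate

/-! ### Direct products -/

section Products

variable {G₁ G₂ : Type*} [Group G₁] [Group G₂]

/-- The homomorphism `φ₁ × φ₂ : P₁ × P₂ → Q₁ × Q₂`, `(x₁, x₂) ↦ (φ₁ x₁, φ₂ x₂)`. -/
def prodHom {P₁ Q₁ : Subgroup G₁} {P₂ Q₂ : Subgroup G₂} (φ₁ : P₁ →* Q₁) (φ₂ : P₂ →* Q₂) :
    ↥(P₁.prod P₂) →* ↥(Q₁.prod Q₂) where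
  toFun x := ⟨(φ₁ ⟨x.1.1, x.2.1⟩, φ₂ ⟨x.1.2, x.2.2⟩), (φ₁ _).2, (φ₂ _).2⟩
  map_one' := Subtype.ext (Prod.ext (congrArg Subtype.val (map_one φ₁))
    (congrArg Subtype.val (map_one φ₂)))
  map_mul' x y := Subtype.ext (Prod.ext
    (congrArg Subtype.val (map_mul φ₁ ⟨x.1.1, x.2.1⟩ ⟨y.1.1, y.2.1⟩))
    (congrArg Subtype.val (map_mul φ₂ ⟨x.1.2, x.2.2⟩ ⟨y.1.2, y.2.2⟩)))

/-- The homomorphisms `φ₁ × φ₂` with `φᵢ` a morphism of `Fᵢ`. -/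
inductive ProdGenerator (F₁ : FusionSystem G₁) (F₂ : FusionSystem G₂) :
    (P Q : Subgroup (G₁ × G₂)) → (P →* Q) → Prop
  | mk {P₁ Q₁ : Subgroup G₁} {P₂ Q₂ : Subgroup G₂} (φ₁ : P₁ →* Q₁) (φ₂ : P₂ →* Q₂)
      (h₁ : φ₁ ∈ F₁.Hom P₁ Q₁) (h₂ : φ₂ ∈ F₂.Hom P₂ Q₂) :
      ProdGenerator F₁ F₂ (P₁.prod P₂) (Q₁.prod Q₂) (prodHom φ₁ φ₂)

/-- The direct product `F₁ × F₂`, over `S₁ × S₂`. -/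
def prod (F₁ : FusionSystem G₁) (F₂ : FusionSystem G₂) : FusionSystem (G₁ × G₂) :=
  generate (F₁.base.prod F₂.base) (fun P Q => {φ | ProdGenerator F₁ F₂ P Q φ})

end Products

/-! ### Morphisms of fusion systems -/

section Morphisms

variable {G G' : Type*} [Group G] [Group G']

/-- The image of a fusion system under an injective homomorphism `f` of the ambient groups: the
fusion system over `f(S)` whose morphisms are the maps `f(P) → f(Q)`, `f x ↦ f (φ x)`. -/
def map (f : G →* G') (hf : Function.Injective f) (F : FusionSystem G) : FusionSystem G' where
  base := F.base.map f
  Hom P' Q' := {ψ | ∃ (P Q : Subgroup G) (φ : P →* Q), φ ∈ F.Hom P Q ∧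
    P' = P.map f ∧ Q' = Q.map f ∧
    ∀ (x : P) (h : f x ∈ P'), (ψ ⟨f x, h⟩ : G') = f (φ x)}
  dom_le := by
    rintro _ _ ψ ⟨P, Q, φ, hφ, rfl, rfl, h⟩
    exact Subgroup.map_mono (F.dom_le hφ)
  cod_le := by
    rintro _ _ ψ ⟨P, Q, φ, hφ, rfl, rfl, h⟩
    exact Subgroup.map_mono (F.cod_le hφ)
  injective := by
    rintro _ _ ψ ⟨P, Q, φ, hφ, rfl, rfl, h⟩
    rintro ⟨_, x, hx, rfl⟩ ⟨_, y, hy, rfl⟩ hxy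
    have := congrArg Subtype.val hxy
    have := (h ⟨x, hx⟩ _).symm.trans (this.trans (h ⟨y, hy⟩ _))
    have := F.injective hφ (Subtype.ext (hf this))
    simp only [Subtype.mk.injEq] at this
    subst this; rfl
  conj_mem := by
    rintro P' Q' ψ _ hP hQ ⟨s, hs, rfl⟩ h
    have hPc : (P'.comap f).map f = P' :=
      Subgroup.map_comap_eq_self (hP.trans (Subgroup.map_le_range f _))
    have hQc : (Q'.comap f).map f = Q' :=
      Subgroup.map_comap_eq_self (hQ.trans (Subgroup.map_le_range f _))
    have hin : ∀ x : ↥(P'.comap f), s * x * s⁻¹ ∈ Q'.comap f := by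
      intro x
      have := h ⟨f x, x.2⟩
      change f (s * x * s⁻¹) ∈ Q'
      rw [map_mul, map_mul, map_inv, ← this]
      exact (ψ _).2
    have hle : ∀ {A : Subgroup G'}, A ≤ F.base.map f → A.comap f ≤ F.base := by
      intro A hA x hx
      obtain ⟨y, hy, hxy⟩ := hA hx
      exact hf hxy ▸ hy
    refine ⟨P'.comap f, Q'.comap f,
      ((MulAut.conj s).toMonoidHom.comp (P'.comap f).subtype).codRestrict (Q'.comap f) hin,
      F.conj_mem _ s (hle hP) (hle hQ) hs (fun x => rfl), hPc.symm, hQc.symm, ?_⟩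
    intro x hx
    rw [h]
    simp
  comp_mem := by
    rintro _ _ _ ψ χ ⟨P, Q, φ, hφ, rfl, rfl, h⟩ ⟨Q₁, R, θ, hθ, hQ, rfl, k⟩
    obtain rfl := Subgroup.map_injective hf hQ
    refine ⟨P, R, θ.comp φ, F.comp_mem hφ hθ, rfl, rfl, ?_⟩
    intro x hx
    have : ψ ⟨f x, hx⟩ = ⟨f (φ x), Subgroup.mem_map_of_mem f (φ x).2⟩ := Subtype.ext (h x hx)
    rw [MonoidHom.comp_apply, this, k]; rfl
  factor := by
    rintro _ _ ψ ⟨P, Q, φ, hφ, rfl, rfl, h⟩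
    obtain ⟨R, hR, e, he, hes, hc⟩ := F.factor hφ
    let eP := P.equivMapOfInjective f hf
    let eR := R.equivMapOfInjective f hf
    have heP : ∀ (x : P) (hx : f x ∈ P.map f), (⟨f x, hx⟩ : ↥(P.map f)) = eP x :=
      fun x hx => Subtype.ext rfl
    have heR : ∀ (x : R) (hx : f x ∈ R.map f), (⟨f x, hx⟩ : ↥(R.map f)) = eR x :=
      fun x hx => Subtype.ext rfl
    refine ⟨R.map f, Subgroup.map_mono hR, (eP.symm.trans e).trans eR,
      ⟨P, R, e.toMonoidHom, he, rfl, rfl, ?_⟩, ⟨R, P, e.symm.toMonoidHom, hes, rfl, rfl, ?_⟩, ?_⟩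
    · intro x hx
      rw [heP x hx]
      simp [eR]
    · intro x hx
      rw [heR x hx]
      simp [eP]
    · ext y
      obtain ⟨x, rfl⟩ := eP.surjective y
      have h3 : (ψ (eP x) : G') = f (φ x) := h x (eP x).2
      rw [h3, hc]
      simp [eR]

variable {S : Subgroup G} {S' : Subgroup G'}

/-- For a homomorphism `α : S → S'` and `P ≤ S`, the subgroup `P^α` of `S'`, as a subgroup of the
ambient group. -/
def imageSubgroup (α : S →* S') (P : Subgroup G) : Subgroup G' :=
  ((P.subgroupOf S).map α).map S'.subtype

/-- Applying first `α` and then `ψ` agrees on `P` with applying first `φ` and then `α`. This is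
used for `P, Q ≤ S` and `P' = P^α`, `Q' = Q^α` only. -/
def Intertwines (α : S →* S') {P Q : Subgroup G} {P' Q' : Subgroup G'} (φ : P →* Q)
    (ψ : P' →* Q') : Prop :=
  ∀ (x : P) (hx : (x : G) ∈ S) (hφx : (φ x : G) ∈ S) (h : (α ⟨x, hx⟩ : G') ∈ P'),
    (ψ ⟨α ⟨x, hx⟩, h⟩ : G') = α ⟨φ x, hφx⟩

/-- `E^α = E'`: the objects of `E'` are the subgroups of `T^α`, where `T = E.base`, and the
morphisms of `E'` are exactly the maps `P^α → Q^α` which are induced by morphisms `P → Q` of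
`E`. -/
def IsImage (α : S →* S') (E : FusionSystem G) (E' : FusionSystem G') : Prop :=
  E.base ≤ S ∧ E'.base = imageSubgroup α E.base ∧
    ∀ (P' Q' : Subgroup G') (ψ : P' →* Q'), ψ ∈ E'.Hom P' Q' ↔
      ∃ (P Q : Subgroup G) (φ : P →* Q), φ ∈ E.Hom P Q ∧
        P' = imageSubgroup α P ∧ Q' = imageSubgroup α Q ∧ Intertwines α φ ψ

/-- `α : S → S'` induces a morphism from `F` to `F'`. -/
def InducesMorphism (F : FusionSystem G) (F' : FusionSystem G') (α : F.base →* F'.base) : Prop :=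
  ∀ (P Q : Subgroup G) (φ : P →* Q), φ ∈ F.Hom P Q →
    ∃ ψ ∈ F'.Hom (imageSubgroup α P) (imageSubgroup α Q), Intertwines α φ ψ

/-- `α : S → S'` induces an epimorphism from `F` to `F'`: it induces a morphism, it is surjective,
and the induced map `Hom_F(P, Q) → Hom_F'(P^α, Q^α)` is surjective for all subgroups `P`, `Q` of
`S` containing the kernel of `α`. As every subgroup of `S'` is the image of one containing the
kernel, this implies `F^α = F'`; see `InducesEpimorphism.isImage`. -/
def InducesEpimorphism (F : FusionSystem G) (F' : FusionSystem G') (α : F.base →* F'.base) :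
    Prop :=
  InducesMorphism F F' α ∧ Function.Surjective α ∧
    ∀ P Q : Subgroup G, P ≤ F.base → Q ≤ F.base →
      α.ker.map F.base.subtype ≤ P → α.ker.map F.base.subtype ≤ Q →
        ∀ ψ ∈ F'.Hom (imageSubgroup α P) (imageSubgroup α Q), ∃ φ ∈ F.Hom P Q, Intertwines α φ ψ

theorem InducesEpimorphism.isImage {F : FusionSystem G} {F' : FusionSystem G'}
    {α : F.base →* F'.base} (h : InducesEpimorphism F F' α) : IsImage α F F' := by
  obtain ⟨h1, h2, h3⟩ := h
  have pre : ∀ P' : Subgroup G', P' ≤ F'.base → ∃ P : Subgroup G, P ≤ F.base ∧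
      α.ker.map F.base.subtype ≤ P ∧ imageSubgroup α P = P' := by
    intro P' hP'
    refine ⟨((P'.subgroupOf F'.base).comap α).map F.base.subtype, Subgroup.map_subtype_le _,
      Subgroup.map_mono (MonoidHom.ker_le_comap α _), ?_⟩
    rw [imageSubgroup, ← Subgroup.comap_subtype,
      Subgroup.comap_map_eq_self_of_injective F.base.subtype_injective,
      Subgroup.map_comap_eq_self_of_surjective h2, Subgroup.subgroupOf_map_subtype,
      inf_eq_left.2 hP']
  refine ⟨le_rfl, ?_, ?_⟩
  · rw [imageSubgroup, Subgroup.subgroupOf_self, ← MonoidHom.range_eq_map,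
      MonoidHom.range_eq_top.2 h2, ← MonoidHom.range_eq_map, Subgroup.range_subtype]
  · intro P' Q' ψ
    constructor
    · intro hψ
      obtain ⟨P, hP, hkP, rfl⟩ := pre P' (F'.dom_le hψ)
      obtain ⟨Q, hQ, hkQ, rfl⟩ := pre Q' (F'.cod_le hψ)
      obtain ⟨φ, hφ, hi⟩ := h3 P Q hP hQ hkP hkQ ψ hψ
      exact ⟨P, Q, φ, hφ, rfl, rfl, hi⟩
    · rintro ⟨P, Q, φ, hφ, rfl, rfl, hi⟩
      obtain ⟨χ, hχ, hi'⟩ := h1 P Q φ hφ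
      have : ψ = χ := by
        ext ⟨_, _, ⟨x, hx, rfl⟩, rfl⟩
        have hxS := F.cod_le hφ (φ ⟨x, hx⟩).2
        exact (hi ⟨x, hx⟩ x.2 hxS _).trans (hi' ⟨x, hx⟩ x.2 hxS _).symm
      rwa [this]

end Morphisms

/-! ### Central products -/

section CentralProducts

variable {G : Type*} [Group G]

/-- The canonical image of `F₁` in `F₁ × F₂`. -/
def inl (F₁ : FusionSystem G) : FusionSystem (G × G) :=
  F₁.map (MonoidHom.inl G G) (fun _ _ h => congrArg Prod.fst h)

/-- The canonical image of `F₂` in `F₁ × F₂`. -/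
def inr (F₂ : FusionSystem G) : FusionSystem (G × G) :=
  F₂.map (MonoidHom.inr G G) (fun _ _ h => congrArg Prod.snd h)

/-- `D` is the (internal) central product of its subsystems `F₁` and `F₂`: one has
`S₁ ∩ S₂ ≤ Z(Fᵢ)`, and the multiplication map `α : S₁ × S₂ → D.base` is a homomorphism which
induces an epimorphism from `F₁ × F₂` to `D` and takes the canonical image of `Fᵢ` to `Fᵢ`. -/
structure IsCentralProduct (D F₁ F₂ : FusionSystem G) : Prop where
  left_le : F₁ ≤ D
  right_le : F₂ ≤ D
  inf_le_left : F₁.base ⊓ F₂.base ≤ F₁.center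
  inf_le_right : F₁.base ⊓ F₂.base ≤ F₂.center
  exists_mul : ∃ α : (F₁.prod F₂).base →* D.base,
    (∀ x : (F₁.prod F₂).base, (α x : G) = (x : G × G).1 * (x : G × G).2) ∧
    InducesEpimorphism (F₁.prod F₂) D α ∧ IsImage α F₁.inl F₁ ∧ IsImage α F₂.inr F₂

/-- The homomorphisms which generate `F₁ * F₂`: the morphisms `ψ : P₁ P₂ → S₁ S₂` of `F` with
`Pᵢ ≤ Sᵢ` whose restriction to `Pᵢ` is a morphism `Pᵢ → Sᵢ` of `Fᵢ`. -/
inductive StarGenerator (F F₁ F₂ : FusionSystem G) : (P Q : Subgroup G) → (P →* Q) → Prop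
  | mk {P₁ P₂ : Subgroup G} (h₁ : P₁ ≤ F₁.base) (h₂ : P₂ ≤ F₂.base)
      (ψ : ↥(P₁ ⊔ P₂) →* ↥(F₁.base ⊔ F₂.base))
      (hψ : ψ ∈ F.Hom (P₁ ⊔ P₂) (F₁.base ⊔ F₂.base))
      (hψ₁ : ∃ φ₁ ∈ F₁.Hom P₁ F₁.base, Extends ψ φ₁)
      (hψ₂ : ∃ φ₂ ∈ F₂.Hom P₂ F₂.base, Extends ψ φ₂) :
      StarGenerator F F₁ F₂ (P₁ ⊔ P₂) (F₁.base ⊔ F₂.base) ψ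

/-- The fusion system `F₁ * F₂` over `S₁ S₂`. It is used when `F₁` and `F₂` are subsystems of `F`
which centralize each other, so that `S₁ S₂ = S₁ ⊔ S₂` and `P₁ P₂ = P₁ ⊔ P₂` for `Pᵢ ≤ Sᵢ`. -/
def star (F F₁ F₂ : FusionSystem G) : FusionSystem G :=
  generate (F₁.base ⊔ F₂.base) (fun P Q => {φ | StarGenerator F F₁ F₂ P Q φ})

end CentralProducts

end FusionSystem

/-! Write `S₁`, `S₂` for the base groups and `Z = S₁ ∩ S₂`. Everything runs through `IsCentralPair`:
`S₁` and `S₂` commute elementwise and `Z` is central in both systems. Then morphisms of `F₁` and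
`F₂` fix `Z` elementwise. Hence for `f₁` on `P₁` and `f₂` on `P₂` the rule `x y ↦ f₁ x * f₂ y` is
well defined on `P₁ P₂`. The restrictions of these maps form a fusion system `centralProd` over `S₁
S₂`.

If the two systems centralize each other, every morphism of `F₁` extends by the identity on `S₂` and
so fixes `Z`, and symmetrically for `F₂`. Saturation turns "fixed elementwise" into "central"
(`IsSaturated.isCentral`), so there is a central pair. The map `x y ↦ f₁ x * f₂ y` is the composite
of an extension of `f₁` that is the identity on `S₂` with an extension of `f₂` that is the identity
on `S₁`, so `centralProd` lies in `F` (`IsCentralPair.centralProd_le`). It coincides with `star`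
(`IsCentralPair.star_eq`) and is a central product (`IsCentralPair.isCentralProduct`). Conversely,
in a central product the image of `f × id` under multiplication is an extension of `f` that is the
identity on the other factor (`IsCentralProduct.centralizeEachOther`).

Saturation of `centralProd` uses the criterion that every subgroup has a fully automized, receptive
conjugate (`isSaturated_of_exists_receptive`). Given `P ≤ S₁ S₂`, first move `P` so that both
projections are fully automized and receptive. A Sylow subgroup of a group of compatible triples
then shows how to move `P` again, keeping the projections, until it is fully automized
(`IsCentralPair.exists_fullyAutomized`). Receptivity follows by extending the two components
separately. The crux is that the factors of an element of `N_φ` lie in the `N_φᵢ`: the obstruction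
lies in the group of automorphisms trivial modulo `Z`, a normal `p`-subgroup, which full
automization absorbs (`IsCentralPair.mem_extensionDomain_proj`). -/

namespace FusionSystem


/-! ### Morphisms as restrictions of functions on the ambient group -/

section Functions

variable {G : Type*} [Group G]

/-- `f` restricts to a morphism of `F` with domain `P`. -/
def Mor (F : FusionSystem G) (P : Subgroup G) (f : G → G) : Prop :=
  ∃ φ ∈ F.Hom P F.base, ∀ x : P, (φ x : G) = f x

variable {F : FusionSystem G} {P Q : Subgroup G} {f g : G → G}

theorem exists_mor {φ : P →* Q} (hφ : φ ∈ F.Hom P Q) :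
    ∃ f, F.Mor P f ∧ ∀ x : P, (φ x : G) = f x := by
  classical
  refine ⟨fun x => if h : x ∈ P then φ ⟨x, h⟩ else 1,
    ⟨_, F.comp_mem hφ (F.inclusion_mem (F.cod_le hφ) le_rfl), ?_⟩, ?_⟩ <;> simp

namespace Mor

theorem le (h : F.Mor P f) : P ≤ F.base := F.dom_le h.choose_spec.1

theorem map_mul (h : F.Mor P f) {x y : G} (hx : x ∈ P) (hy : y ∈ P) :
    f (x * y) = f x * f y := by
  obtain ⟨φ, -, h⟩ := h
  have := congrArg Subtype.val (φ.map_mul ⟨x, hx⟩ ⟨y, hy⟩)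
  rw [h] at this
  simpa [h] using this

theorem map_one (h : F.Mor P f) : f 1 = 1 := by
  have := h.map_mul P.one_mem P.one_mem
  simpa using this

theorem map_inv (h : F.Mor P f) {x : G} (hx : x ∈ P) : f x⁻¹ = (f x)⁻¹ := by
  have := h.map_mul (P.inv_mem hx) hx
  rw [inv_mul_cancel, h.map_one] at this
  exact eq_inv_of_mul_eq_one_left this.symm

theorem mem (h : F.Mor P f) {x : G} (hx : x ∈ P) : f x ∈ F.base := by
  obtain ⟨φ, -, h⟩ := h
  rw [← h ⟨x, hx⟩]
  exact (φ _).2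

theorem eq_of_eq (h : F.Mor P f) {x y : G} (hx : x ∈ P) (hy : y ∈ P) (hxy : f x = f y) :
    x = y := by
  obtain ⟨φ, hφ, h⟩ := h
  have : φ ⟨x, hx⟩ = φ ⟨y, hy⟩ := Subtype.ext (by rw [h, h]; exact hxy)
  exact congrArg Subtype.val (F.injective hφ this)

theorem congr (h : F.Mor P f) (hfg : ∀ x ∈ P, f x = g x) : F.Mor P g := by
  obtain ⟨φ, hφ, h⟩ := h
  exact ⟨φ, hφ, fun x => (h x).trans (hfg x x.2)⟩

theorem mono (h : F.Mor P f) (hQ : Q ≤ P) : F.Mor Q f := by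
  obtain ⟨φ, hφ, h⟩ := h
  exact ⟨φ.comp (Subgroup.inclusion hQ), F.comp_mem (F.inclusion_mem hQ (F.dom_le hφ)) hφ,
    fun x => h (Subgroup.inclusion hQ x)⟩

theorem mem_hom (h : F.Mor P f) (hQ : Q ≤ F.base) (φ : P →* Q) (hφ : ∀ x : P, (φ x : G) = f x) :
    φ ∈ F.Hom P Q := by
  obtain ⟨ψ, hψ, h⟩ := h
  exact F.restrict_mem hψ hQ φ ⟨le_rfl, fun x => (h x).trans (hφ x).symm⟩

theorem exists_hom (h : F.Mor P f) (hQ : Q ≤ F.base) (hfQ : ∀ x ∈ P, f x ∈ Q) :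
    ∃ φ ∈ F.Hom P Q, ∀ x : P, (φ x : G) = f x := by
  let φ : P →* Q :=
    { toFun := fun x => ⟨f x, hfQ x x.2⟩
      map_one' := Subtype.ext h.map_one
      map_mul' := fun x y => Subtype.ext (h.map_mul x.2 y.2) }
  exact ⟨φ, h.mem_hom hQ φ fun _ => rfl, fun _ => rfl⟩

theorem exists_equiv (h : F.Mor P f) (hQ : ∀ y, y ∈ Q ↔ ∃ x ∈ P, f x = y) :
    ∃ e : P ≃* Q, e.toMonoidHom ∈ F.Hom P Q ∧ ∀ x : P, (e x : G) = f x := by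
  have hQb : Q ≤ F.base := by
    intro y hy
    obtain ⟨x, hx, rfl⟩ := (hQ y).1 hy
    exact h.mem hx
  obtain ⟨φ, hφ, hf⟩ := h.exists_hom hQb (fun x hx => (hQ _).2 ⟨x, hx, rfl⟩)
  have hbij : Function.Bijective φ := by
    refine ⟨F.injective hφ, fun y => ?_⟩
    obtain ⟨x, hx, hxy⟩ := (hQ y).1 y.2
    exact ⟨⟨x, hx⟩, Subtype.ext ((hf _).trans hxy)⟩
  refine ⟨MulEquiv.ofBijective φ hbij, ?_, hf⟩
  exact h.mem_hom hQb _ hf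

theorem conj (hP : P ≤ F.base) {s : G} (hs : s ∈ F.base) : F.Mor P (fun x => s * x * s⁻¹) := by
  have h : ∀ x ∈ P, s * x * s⁻¹ ∈ F.base := fun x hx =>
    F.base.mul_mem (F.base.mul_mem hs (hP hx)) (F.base.inv_mem hs)
  let φ : P →* F.base := ((MulAut.conj s).toMonoidHom.comp P.subtype).codRestrict F.base
    (fun x => h x x.2)
  exact ⟨φ, F.conj_mem φ s hP le_rfl hs fun _ => rfl, fun _ => rfl⟩

theorem id (hP : P ≤ F.base) : F.Mor P (fun x => x) :=
  (conj hP F.base.one_mem).congr (by simp)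

theorem comp (hf : F.Mor P f) (hfQ : ∀ x ∈ P, f x ∈ Q) (hg : F.Mor Q g) :
    F.Mor P (fun x => g (f x)) := by
  obtain ⟨φ, hφ, h⟩ := hf.exists_hom hg.le hfQ
  obtain ⟨ψ, hψ, k⟩ := hg
  refine ⟨ψ.comp φ, F.comp_mem hφ hψ, fun x => ?_⟩
  rw [MonoidHom.comp_apply, k, h]

/-- The image of `P` under a morphism with domain `P`. -/
def range (h : F.Mor P f) : Subgroup G where
  carrier := f '' P
  one_mem' := ⟨1, P.one_mem, h.map_one⟩
  mul_mem' := by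
    rintro _ _ ⟨x, hx, rfl⟩ ⟨y, hy, rfl⟩
    exact ⟨x * y, P.mul_mem hx hy, h.map_mul hx hy⟩
  inv_mem' := by
    rintro _ ⟨x, hx, rfl⟩
    exact ⟨x⁻¹, P.inv_mem hx, h.map_inv hx⟩

theorem mem_range (h : F.Mor P f) {y : G} : y ∈ h.range ↔ ∃ x ∈ P, f x = y := Iff.rfl

theorem range_le (h : F.Mor P f) : h.range ≤ F.base := by
  rintro _ ⟨x, hx, rfl⟩
  exact h.mem hx

theorem inv (hf : F.Mor P f) (hQ : ∀ y ∈ Q, ∃ x ∈ P, f x = y) (hg : ∀ x ∈ P, g (f x) = x) :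
    F.Mor Q g := by
  obtain ⟨e, he, h⟩ := hf.exists_equiv (Q := hf.range) (fun y => Iff.rfl)
  have h2 : F.Mor hf.range g := by
    refine ⟨_, F.comp_mem (F.exists_equiv_of_mem he hf.range e fun _ => rfl).2
      (F.inclusion_mem hf.le le_rfl), ?_⟩
    intro y
    obtain ⟨x, rfl⟩ := e.surjective y
    rw [h, hg x x.2]
    simp
  exact h2.mono hQ

theorem exists_inv (hf : F.Mor P f) (hQ : ∀ y ∈ Q, ∃ x ∈ P, f x = y) :
    ∃ g, F.Mor Q g ∧ (∀ x ∈ P, g (f x) = x) ∧ ∀ y ∈ Q, g y ∈ P ∧ f (g y) = y := by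
  have hl : ∀ x ∈ P, Function.invFunOn f P (f x) = x := fun x hx =>
    hf.eq_of_eq (Function.invFunOn_mem ⟨x, hx, rfl⟩) hx (Function.invFunOn_eq ⟨x, hx, rfl⟩)
  refine ⟨Function.invFunOn f P, hf.inv hQ hl, hl, fun y hy => ?_⟩
  obtain ⟨x, hx, rfl⟩ := hQ y hy
  rw [hl x hx]
  exact ⟨hx, rfl⟩

end Mor

theorem mor_of_mem {φ : P →* Q} (hφ : φ ∈ F.Hom P Q) (h : ∀ x : P, (φ x : G) = f x) :
    F.Mor P f := by
  obtain ⟨g, hg, hgf⟩ := exists_mor hφ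
  exact hg.congr fun x hx => (hgf ⟨x, hx⟩).symm.trans (h ⟨x, hx⟩)

theorem le_iff_mor {E F : FusionSystem G} :
    E ≤ F ↔ E.base ≤ F.base ∧ ∀ P f, E.Mor P f → F.Mor P f := by
  constructor
  · rintro ⟨hb, h⟩
    refine ⟨hb, ?_⟩
    rintro P f ⟨φ, hφ, hf⟩
    exact mor_of_mem (h _ _ hφ) hf
  · rintro ⟨hb, h⟩
    refine ⟨hb, fun P Q φ hφ => ?_⟩
    obtain ⟨f, hf, hφf⟩ := exists_mor hφ
    exact (h P f hf).mem_hom ((E.cod_le hφ).trans hb) φ hφf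

theorem ext_mor {E F : FusionSystem G} (hb : E.base = F.base)
    (h : ∀ P f, E.Mor P f ↔ F.Mor P f) : E = F := by
  have h1 : E ≤ F := le_iff_mor.2 ⟨hb.le, fun P f => (h P f).1⟩
  have h2 : F ≤ E := le_iff_mor.2 ⟨hb.ge, fun P f => (h P f).2⟩
  refine FusionSystem.ext hb ?_
  funext P Q
  exact Set.Subset.antisymm (h1.2 P Q) (h2.2 P Q)

/-- The fusion system over `S` whose morphisms are the restrictions of functions `f` to subgroups
`P` with `M P f`. -/
def ofMor (S : Subgroup G) (M : Subgroup G → (G → G) → Prop)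
    (le : ∀ {P f}, M P f → P ≤ S)
    (inj : ∀ {P f}, M P f → Set.InjOn f P)
    (conj : ∀ {P s}, P ≤ S → s ∈ S → M P (fun x => s * x * s⁻¹))
    (comp : ∀ {P Q f g}, M P f → (∀ x ∈ P, f x ∈ Q) → M Q g → M P (fun x => g (f x)))
    (inv : ∀ {P Q f g}, M P f → (∀ y, y ∈ Q ↔ ∃ x ∈ P, f x = y) → (∀ x ∈ P, g (f x) = x) →
      Q ≤ S → M Q g) :
    FusionSystem G where
  base := S
  Hom P Q := {φ | Q ≤ S ∧ ∃ f, M P f ∧ ∀ x : P, (φ x : G) = f x}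
  dom_le := fun ⟨_, _, h, _⟩ => le h
  cod_le := fun h => h.1
  injective := by
    rintro P Q φ ⟨-, f, hf, h⟩ x y hxy
    exact Subtype.ext (inj hf x.2 y.2 (by rw [← h, ← h, hxy]))
  conj_mem := fun φ s hP hQ hs h => ⟨hQ, _, conj hP hs, h⟩
  comp_mem := by
    rintro P Q R φ ψ ⟨-, f, hf, hφ⟩ ⟨hR, g, hg, hψ⟩
    refine ⟨hR, _, comp hf (fun x hx => ?_) hg, fun x => ?_⟩
    · rw [← hφ ⟨x, hx⟩]; exact (φ _).2
    · rw [MonoidHom.comp_apply, hψ, hφ]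
  factor := by
    rintro P Q φ ⟨hQ, f, hf, h⟩
    have hinj : Function.Injective φ := fun x y hxy =>
      Subtype.ext (inj hf x.2 y.2 (by rw [← h, ← h, hxy]))
    obtain ⟨R, hR, e, he⟩ := exists_image φ hinj
    have key : ∀ y : R, (e.symm y : G) = Function.invFunOn f P y := by
      intro y
      obtain ⟨x, rfl⟩ := e.surjective y
      rw [he, h, MulEquiv.symm_apply_apply]
      exact (inj hf).leftInvOn_invFunOn x.2 |>.symm
    refine ⟨R, hR, e, ⟨hR.trans hQ, f, hf, fun x => (he x).trans (h x)⟩,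
      ⟨le hf, _, inv hf (fun y => ?_) (fun x hx => (inj hf).leftInvOn_invFunOn hx)
        (hR.trans hQ), key⟩, ?_⟩
    · constructor
      · intro hy
        refine ⟨e.symm ⟨y, hy⟩, (e.symm ⟨y, hy⟩).2, ?_⟩
        rw [← h, ← he, MulEquiv.apply_symm_apply]
      · rintro ⟨x, hx, rfl⟩
        rw [← h ⟨x, hx⟩, ← he]
        exact (e _).2
    · ext x; exact (he x).symm

end Functions


/-! ### Central pairs and the construction of their central product -/

section CentralPairs

variable {G : Type*} [Group G]

theorem mem_sup_of_commute {A B : Subgroup G} (hc : ∀ a ∈ A, ∀ b ∈ B, a * b = b * a) {x : G} :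
    x ∈ A ⊔ B ↔ ∃ a ∈ A, ∃ b ∈ B, a * b = x := by
  constructor
  · intro hx
    let H : Subgroup G :=
      { carrier := {x | ∃ a ∈ A, ∃ b ∈ B, a * b = x}
        one_mem' := ⟨1, A.one_mem, 1, B.one_mem, mul_one 1⟩
        mul_mem' := by
          rintro _ _ ⟨a, ha, b, hb, rfl⟩ ⟨a', ha', b', hb', rfl⟩
          refine ⟨a * a', A.mul_mem ha ha', b * b', B.mul_mem hb hb', ?_⟩
          rw [mul_assoc, mul_assoc, ← mul_assoc a', ← mul_assoc b, hc a' ha' b hb]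
        inv_mem' := by
          rintro _ ⟨a, ha, b, hb, rfl⟩
          refine ⟨a⁻¹, A.inv_mem ha, b⁻¹, B.inv_mem hb, ?_⟩
          rw [hc _ (A.inv_mem ha) _ (B.inv_mem hb), mul_inv_rev] }
    have hH : A ⊔ B ≤ H := sup_le (fun a ha => ⟨a, ha, 1, B.one_mem, mul_one a⟩)
      (fun b hb => ⟨1, A.one_mem, b, hb, one_mul b⟩)
    exact hH hx
  · rintro ⟨a, ha, b, hb, rfl⟩
    exact Subgroup.mul_mem_sup ha hb

/-- The base groups of `F₁` and `F₂` commute and intersect in a subgroup that is central in both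
fusion systems. -/
structure IsCentralPair (F₁ F₂ : FusionSystem G) : Prop where
  comm : ∀ x ∈ F₁.base, ∀ y ∈ F₂.base, x * y = y * x
  left : F₁.IsCentral (F₁.base ⊓ F₂.base)
  right : F₂.IsCentral (F₂.base ⊓ F₁.base)

theorem IsCentral.exists_extension {F : FusionSystem G} {Z P : Subgroup G} {f : G → G}
    (hZ : F.IsCentral Z) (h : F.Mor P f) :
    ∃ g, F.Mor (P ⊔ Z) g ∧ (∀ x ∈ P, g x = f x) ∧ ∀ z ∈ Z, g z = z := by
  obtain ⟨φ, hφ, hf⟩ := h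
  obtain ⟨ψ, hψ, ⟨i1, k1⟩, ⟨i2, k2⟩⟩ := ((isCentral_iff F Z).1 hZ).2.2 _ _ φ hφ
  obtain ⟨g, hg, hgf⟩ := exists_mor hψ
  exact ⟨g, hg, fun x hx => (hgf ⟨x, i1 hx⟩).symm.trans ((k1 ⟨x, hx⟩).trans (hf ⟨x, hx⟩)),
    fun z hz => (hgf ⟨z, i2 hz⟩).symm.trans (k2 ⟨z, hz⟩)⟩

/-- The extension of `f` to `P Z` agrees with `f` on `P` and with the identity on `Z`. -/
theorem IsCentral.apply_eq {F : FusionSystem G} {Z P : Subgroup G} {f : G → G}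
    (hZ : F.IsCentral Z) (h : F.Mor P f) {z : G} (hzP : z ∈ P) (hz : z ∈ Z) : f z = z := by
  obtain ⟨g, -, hgf, hgz⟩ := hZ.exists_extension h
  rw [← hgf z hzP, hgz z hz]

namespace IsCentralPair

variable {F₁ F₂ : FusionSystem G} {P P₁ P₂ Q : Subgroup G} {f f₁ f₂ g : G → G}

theorem symm (h : IsCentralPair F₁ F₂) : IsCentralPair F₂ F₁ :=
  ⟨fun x hx y hy => (h.comm y hy x hx).symm, h.right, h.left⟩

theorem apply_left (h : IsCentralPair F₁ F₂) (hf : F₁.Mor P f) {z : G} (hP : z ∈ P)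
    (h₁ : z ∈ F₁.base) (h₂ : z ∈ F₂.base) : f z = z :=
  h.left.apply_eq hf hP ⟨h₁, h₂⟩

theorem mem_sup (h : IsCentralPair F₁ F₂) (h₁ : P₁ ≤ F₁.base) (h₂ : P₂ ≤ F₂.base) {x : G} :
    x ∈ P₁ ⊔ P₂ ↔ ∃ a ∈ P₁, ∃ b ∈ P₂, a * b = x :=
  mem_sup_of_commute fun a ha b hb => h.comm a (h₁ ha) b (h₂ hb)

theorem mul_mul_mul_comm (h : IsCentralPair F₁ F₂) {a b c d : G} (hb : b ∈ F₂.base)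
    (hc : c ∈ F₁.base) : a * b * (c * d) = a * c * (b * d) := by
  rw [mul_assoc, mul_assoc, ← mul_assoc b, ← mul_assoc c, h.comm c hc b hb]

/-- Two factorizations of the same element differ by an element of the intersection. -/
theorem exists_of_mul_eq_mul (_h : IsCentralPair F₁ F₂) {a a' b b' : G} (ha : a ∈ F₁.base)
    (ha' : a' ∈ F₁.base) (hb : b ∈ F₂.base) (hb' : b' ∈ F₂.base) (hab : a * b = a' * b') :
    ∃ z ∈ F₁.base, z ∈ F₂.base ∧ a = a' * z ∧ b' = z * b := by
  have hz : a'⁻¹ * a = b' * b⁻¹ := by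
    rw [eq_mul_inv_iff_mul_eq, mul_assoc, hab, inv_mul_cancel_left]
  refine ⟨a'⁻¹ * a, mul_mem (inv_mem ha') ha, ?_, by simp, ?_⟩
  · rw [hz]; exact mul_mem hb' (inv_mem hb)
  · rw [hz]; simp

/-- The projection of a subgroup of `S₁ S₂` to `S₁`. It contains `S₁ ∩ S₂`. -/
def proj (h : IsCentralPair F₁ F₂) (P : Subgroup G) : Subgroup G where
  carrier := {x | x ∈ F₁.base ∧ ∃ y ∈ F₂.base, x * y ∈ P}
  one_mem' := ⟨one_mem _, 1, one_mem _, by simp⟩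
  mul_mem' := by
    rintro a b ⟨ha, y, hy, hay⟩ ⟨hb, z, hz, hbz⟩
    refine ⟨mul_mem ha hb, y * z, mul_mem hy hz, ?_⟩
    rw [← h.mul_mul_mul_comm hy hb]
    exact mul_mem hay hbz
  inv_mem' := by
    rintro a ⟨ha, y, hy, hay⟩
    refine ⟨inv_mem ha, y⁻¹, inv_mem hy, ?_⟩
    rw [h.comm _ (inv_mem ha) _ (inv_mem hy), ← mul_inv_rev]
    exact inv_mem hay

theorem mem_proj_symm (h : IsCentralPair F₁ F₂) {y : G} :
    y ∈ h.symm.proj P ↔ y ∈ F₂.base ∧ ∃ x ∈ F₁.base, x * y ∈ P := by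
  refine and_congr_right fun hy => exists_congr fun x => and_congr_right fun hx => ?_
  rw [h.comm x hx y hy]

theorem mem_proj_of_mem_inf (h : IsCentralPair F₁ F₂) {x : G} (h₁ : x ∈ F₁.base)
    (h₂ : x ∈ F₂.base) : x ∈ h.proj P :=
  ⟨h₁, x⁻¹, inv_mem h₂, by simp⟩

theorem proj_le (h : IsCentralPair F₁ F₂) : h.proj P ≤ F₁.base := fun _ hx => hx.1

theorem le_proj_sup (h : IsCentralPair F₁ F₂) (hP : P ≤ F₁.base ⊔ F₂.base) :
    P ≤ h.proj P ⊔ h.symm.proj P := by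
  intro x hx
  obtain ⟨a, ha, b, hb, rfl⟩ := (h.mem_sup le_rfl le_rfl).1 (hP hx)
  exact Subgroup.mul_mem_sup ⟨ha, b, hb, hx⟩ (h.mem_proj_symm.2 ⟨hb, a, ha, hx⟩)

/-- Well-definedness of `x y ↦ f₁ x * f₂ y`: two factorizations differ by some `z` lying in both
`P₁` and `P₂`, and both maps fix `z`. -/
theorem mul_apply_eq (h : IsCentralPair F₁ F₂) (h₁ : F₁.Mor P₁ f₁) (h₂ : F₂.Mor P₂ f₂)
    {a a' b b' : G} (ha : a ∈ P₁) (ha' : a' ∈ P₁) (hb : b ∈ P₂) (hb' : b' ∈ P₂)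
    (hab : a * b = a' * b') : f₁ a * f₂ b = f₁ a' * f₂ b' := by
  obtain ⟨z, hz₁, hz₂, rfl, rfl⟩ :=
    h.exists_of_mul_eq_mul (h₁.le ha) (h₁.le ha') (h₂.le hb) (h₂.le hb') hab
  have hzP₁ : z ∈ P₁ := by simpa using mul_mem (inv_mem ha') ha
  have hzP₂ : z ∈ P₂ := by simpa using mul_mem hb' (inv_mem hb)
  rw [h₁.map_mul ha' hzP₁, h₂.map_mul hzP₂ hb, h.apply_left h₁ hzP₁ hz₁ hz₂,
    h.symm.apply_left h₂ hzP₂ hz₂ hz₁, mul_assoc]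

theorem exists_mul_apply (h : IsCentralPair F₁ F₂) (h₁ : F₁.Mor P₁ f₁) (h₂ : F₂.Mor P₂ f₂) :
    ∃ f : G → G, ∀ x ∈ P₁, ∀ y ∈ P₂, f (x * y) = f₁ x * f₂ y := by
  classical
  refine ⟨fun g => if hg : ∃ x ∈ P₁, ∃ y ∈ P₂, x * y = g then
    f₁ hg.choose * f₂ hg.choose_spec.2.choose else 1, fun x hx y hy => ?_⟩
  have hg : ∃ x' ∈ P₁, ∃ y' ∈ P₂, x' * y' = x * y := ⟨x, hx, y, hy, rfl⟩
  beta_reduce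
  rw [dif_pos hg]
  exact h.mul_apply_eq h₁ h₂ hg.choose_spec.1 hx hg.choose_spec.2.choose_spec.1 hy
    hg.choose_spec.2.choose_spec.2

/-- The functions whose restrictions to `P` are the morphisms of the central product. -/
def MulMor (h : IsCentralPair F₁ F₂) (P : Subgroup G) (f : G → G) : Prop :=
  P ≤ F₁.base ⊔ F₂.base ∧ ∃ f₁ f₂, F₁.Mor (h.proj P) f₁ ∧ F₂.Mor (h.symm.proj P) f₂ ∧
    ∀ x ∈ F₁.base, ∀ y ∈ F₂.base, x * y ∈ P → f (x * y) = f₁ x * f₂ y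

/-- A factorization of a value of `f` comes from a factorization of the argument. -/
theorem exists_lift (h : IsCentralPair F₁ F₂) (h₁ : F₁.Mor (h.proj P) f₁)
    (h₂ : F₂.Mor (h.symm.proj P) f₂)
    (hf : ∀ x ∈ F₁.base, ∀ y ∈ F₂.base, x * y ∈ P → f (x * y) = f₁ x * f₂ y)
    (hP : P ≤ F₁.base ⊔ F₂.base) {p a b : G} (hp : p ∈ P) (ha : a ∈ F₁.base) (hb : b ∈ F₂.base)
    (hab : f p = a * b) :
    ∃ x ∈ F₁.base, ∃ y ∈ F₂.base, x * y = p ∧ f₁ x = a ∧ f₂ y = b := by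
  obtain ⟨x, hx, y, hy, rfl⟩ := (h.mem_sup le_rfl le_rfl).1 (hP hp)
  have hxP : x ∈ h.proj P := ⟨hx, y, hy, hp⟩
  have hyP : y ∈ h.symm.proj P := h.mem_proj_symm.2 ⟨hy, x, hx, hp⟩
  rw [hf x hx y hy hp] at hab
  obtain ⟨z, hz₁, hz₂, rfl, hz⟩ :=
    h.exists_of_mul_eq_mul ha (h₁.mem hxP) hb (h₂.mem hyP) hab.symm
  have hzP₁ : z ∈ h.proj P := h.mem_proj_of_mem_inf hz₁ hz₂
  have hzP₂ : z ∈ h.symm.proj P := h.symm.mem_proj_of_mem_inf hz₂ hz₁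
  -- Since `f₁` and `f₂` fix `z`, the discrepancy between the factorizations of the value can be
  -- moved to the argument.
  refine ⟨x * z, mul_mem hx hz₁, z⁻¹ * y, mul_mem (inv_mem hz₂) hy, by simp [mul_assoc], ?_, ?_⟩
  · rw [h₁.map_mul hxP hzP₁, h.apply_left h₁ hzP₁ hz₁ hz₂]
  · rw [h₂.map_mul (inv_mem hzP₂) hyP, h₂.map_inv hzP₂, h.symm.apply_left h₂ hzP₂ hz₂ hz₁, hz,
      inv_mul_cancel_left]

namespace MulMor

variable {h : IsCentralPair F₁ F₂}

theorem congr (hf : h.MulMor P f) (hfg : ∀ x ∈ P, f x = g x) : h.MulMor P g := by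
  obtain ⟨hP, f₁, f₂, h₁, h₂, hf⟩ := hf
  exact ⟨hP, f₁, f₂, h₁, h₂, fun x hx y hy hxy => (hfg _ hxy).symm.trans (hf x hx y hy hxy)⟩

theorem injOn (hf : h.MulMor P f) : Set.InjOn f P := by
  obtain ⟨hP, f₁, f₂, h₁, h₂, hf⟩ := hf
  intro p hp q hq hpq
  obtain ⟨x, hx, y, hy, rfl⟩ := (h.mem_sup le_rfl le_rfl).1 (hP hq)
  have hxP : x ∈ h.proj P := ⟨hx, y, hy, hq⟩
  have hyP : y ∈ h.symm.proj P := h.mem_proj_symm.2 ⟨hy, x, hx, hq⟩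
  rw [hf x hx y hy hq] at hpq
  obtain ⟨x', hx', y', hy', rfl, hxx, hyy⟩ :=
    h.exists_lift h₁ h₂ hf hP hp (h₁.mem hxP) (h₂.mem hyP) hpq
  rw [h₁.eq_of_eq ⟨hx', y', hy', hp⟩ hxP hxx,
    h₂.eq_of_eq (h.mem_proj_symm.2 ⟨hy', x', hx', hp⟩) hyP hyy]

theorem conj (hP : P ≤ F₁.base ⊔ F₂.base) {s : G} (hs : s ∈ F₁.base ⊔ F₂.base) :
    h.MulMor P (fun x => s * x * s⁻¹) := by
  obtain ⟨s₁, hs₁, s₂, hs₂, rfl⟩ := (h.mem_sup le_rfl le_rfl).1 hs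
  refine ⟨hP, _, _, .conj h.proj_le hs₁, .conj h.symm.proj_le hs₂, fun x hx y hy hxy => ?_⟩
  beta_reduce
  rw [h.mul_mul_mul_comm hs₂ hx, h.comm s₁ hs₁ s₂ hs₂, mul_inv_rev,
    h.mul_mul_mul_comm (mul_mem hs₂ hy) (inv_mem hs₁)]

theorem comp (hf : h.MulMor P f) (hfQ : ∀ x ∈ P, f x ∈ Q) (hg : h.MulMor Q g) :
    h.MulMor P (fun x => g (f x)) := by
  obtain ⟨hP, f₁, f₂, h₁, h₂, hf⟩ := hf
  obtain ⟨hQ, g₁, g₂, k₁, k₂, hg⟩ := hg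
  have key : ∀ x ∈ F₁.base, ∀ y ∈ F₂.base, x * y ∈ P →
      f₁ x ∈ F₁.base ∧ f₂ y ∈ F₂.base ∧ f₁ x * f₂ y ∈ Q := by
    intro x hx y hy hxy
    refine ⟨h₁.mem ⟨hx, y, hy, hxy⟩, h₂.mem (h.mem_proj_symm.2 ⟨hy, x, hx, hxy⟩), ?_⟩
    rw [← hf x hx y hy hxy]
    exact hfQ _ hxy
  refine ⟨hP, _, _, h₁.comp ?_ k₁, h₂.comp ?_ k₂, fun x hx y hy hxy => ?_⟩
  · rintro x ⟨hx, y, hy, hxy⟩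
    obtain ⟨a, b, c⟩ := key x hx y hy hxy
    exact ⟨a, _, b, c⟩
  · intro y hy
    obtain ⟨hy, x, hx, hxy⟩ := h.mem_proj_symm.1 hy
    obtain ⟨a, b, c⟩ := key x hx y hy hxy
    exact h.mem_proj_symm.2 ⟨b, _, a, c⟩
  · obtain ⟨a, b, c⟩ := key x hx y hy hxy
    beta_reduce
    rw [hf x hx y hy hxy, hg _ a _ b c]

/-- Factorizations of elements of `Q` lift along `f` by `exists_lift`, so the projections of `Q` lie
in the images of `f₁` and `f₂`, and the componentwise inverses are defined there. -/
theorem inv (hf : h.MulMor P f) (hQ : ∀ y, y ∈ Q ↔ ∃ x ∈ P, f x = y)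
    (hg : ∀ x ∈ P, g (f x) = x) (hQb : Q ≤ F₁.base ⊔ F₂.base) : h.MulMor Q g := by
  obtain ⟨hP, f₁, f₂, h₁, h₂, hf⟩ := hf
  have key : ∀ a ∈ F₁.base, ∀ b ∈ F₂.base, a * b ∈ Q →
      ∃ x ∈ F₁.base, ∃ y ∈ F₂.base, x * y ∈ P ∧ f₁ x = a ∧ f₂ y = b := by
    intro a ha b hb hab
    obtain ⟨p, hp, hpab⟩ := (hQ _).1 hab
    obtain ⟨x, hx, y, hy, rfl, hxa, hyb⟩ := h.exists_lift h₁ h₂ hf hP hp ha hb hpab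
    exact ⟨x, hx, y, hy, hp, hxa, hyb⟩
  obtain ⟨g₁, hg₁, hgf₁, -⟩ := h₁.exists_inv (Q := h.proj Q) (by
    rintro a ⟨ha, b, hb, hab⟩
    obtain ⟨x, hx, y, hy, hp, hxa, hyb⟩ := key a ha b hb hab
    exact ⟨x, ⟨hx, y, hy, hp⟩, hxa⟩)
  obtain ⟨g₂, hg₂, hgf₂, -⟩ := h₂.exists_inv (Q := h.symm.proj Q) (by
    intro b hb
    obtain ⟨hb, a, ha, hab⟩ := h.mem_proj_symm.1 hb
    obtain ⟨x, hx, y, hy, hp, hxa, hyb⟩ := key a ha b hb hab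
    exact ⟨y, h.mem_proj_symm.2 ⟨hy, x, hx, hp⟩, hyb⟩)
  refine ⟨hQb, g₁, g₂, hg₁, hg₂, fun a ha b hb hab => ?_⟩
  obtain ⟨x, hx, y, hy, hp, rfl, rfl⟩ := key a ha b hb hab
  rw [hgf₁ x ⟨hx, y, hy, hp⟩, hgf₂ y (h.mem_proj_symm.2 ⟨hy, x, hx, hp⟩), ← hf x hx y hy hp,
    hg _ hp]

end MulMor

/-- The central product of `F₁` and `F₂`, over `S₁ S₂`. -/
def centralProd (h : IsCentralPair F₁ F₂) : FusionSystem G :=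
  ofMor (F₁.base ⊔ F₂.base) h.MulMor (fun hf => hf.1) MulMor.injOn
    (fun hP hs => MulMor.conj hP hs)
    MulMor.comp MulMor.inv

/-- `MulMor` only prescribes values. The content is that such an `f` is multiplicative on `P` with
values in `S₁ S₂`, so that it does restrict to a homomorphism. -/
theorem mor_centralProd (h : IsCentralPair F₁ F₂) : h.centralProd.Mor P f ↔ h.MulMor P f := by
  constructor
  · rintro ⟨φ, ⟨-, g, hg, hφg⟩, hφf⟩
    exact hg.congr fun x hx => (hφg ⟨x, hx⟩).symm.trans (hφf ⟨x, hx⟩)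
  · intro hf
    obtain ⟨hP, f₁, f₂, h₁, h₂, hfm⟩ := id hf
    have key : ∀ p ∈ P, ∃ x ∈ F₁.base, ∃ y ∈ F₂.base, x * y = p ∧ x ∈ h.proj P ∧
        y ∈ h.symm.proj P ∧ f p = f₁ x * f₂ y := by
      intro p hp
      obtain ⟨x, hx, y, hy, rfl⟩ := (h.mem_sup le_rfl le_rfl).1 (hP hp)
      exact ⟨x, hx, y, hy, rfl, ⟨hx, y, hy, hp⟩, h.mem_proj_symm.2 ⟨hy, x, hx, hp⟩,
        hfm x hx y hy hp⟩
    have hmul : ∀ p ∈ P, ∀ q ∈ P, f (p * q) = f p * f q := by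
      intro p hp q hq
      obtain ⟨x, hx, y, hy, rfl, hxP, hyP, e⟩ := key p hp
      obtain ⟨x', hx', y', hy', rfl, hxP', hyP', e'⟩ := key q hq
      have hpq := mul_mem hp hq
      rw [e, e', h.mul_mul_mul_comm (h₂.mem hyP) (h₁.mem hxP'), ← h₁.map_mul hxP hxP',
        ← h₂.map_mul hyP hyP']
      rw [h.mul_mul_mul_comm hy hx'] at hpq ⊢
      exact hfm _ (mul_mem hx hx') _ (mul_mem hy hy') hpq
    have hmem : ∀ p ∈ P, f p ∈ F₁.base ⊔ F₂.base := by
      intro p hp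
      obtain ⟨x, hx, y, hy, rfl, hxP, hyP, e⟩ := key p hp
      rw [e]
      exact Subgroup.mul_mem_sup (h₁.mem hxP) (h₂.mem hyP)
    let φ : P →* h.centralProd.base :=
      MonoidHom.mk' (fun p => (⟨f p, hmem p p.2⟩ : ↥(F₁.base ⊔ F₂.base)))
        (fun p q => Subtype.ext (hmul p p.2 q q.2))
    exact ⟨φ, ⟨le_rfl, f, hf, fun _ => rfl⟩, fun _ => rfl⟩

/-- The projections of `P₁ P₂` can exceed `P₁` and `P₂`, but only by `S₁ ∩ S₂`. Centrality extends
both maps by the identity there. -/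
theorem mor_centralProd_sup (h : IsCentralPair F₁ F₂) (h₁ : F₁.Mor P₁ f₁) (h₂ : F₂.Mor P₂ f₂)
    (hf : ∀ x ∈ P₁, ∀ y ∈ P₂, f (x * y) = f₁ x * f₂ y) : h.centralProd.Mor (P₁ ⊔ P₂) f := by
  obtain ⟨g₁, hg₁, hgf₁, hgz₁⟩ := h.left.exists_extension h₁
  obtain ⟨g₂, hg₂, hgf₂, hgz₂⟩ := h.right.exists_extension h₂
  have key : ∀ a ∈ F₁.base, ∀ b ∈ F₂.base, a * b ∈ P₁ ⊔ P₂ →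
      a ∈ P₁ ⊔ (F₁.base ⊓ F₂.base) ∧ b ∈ P₂ ⊔ (F₂.base ⊓ F₁.base) := by
    intro a ha b hb hab
    obtain ⟨x, hx, y, hy, hxy⟩ := (h.mem_sup h₁.le h₂.le).1 hab
    obtain ⟨z, hz₁, hz₂, rfl, rfl⟩ :=
      h.exists_of_mul_eq_mul ha (h₁.le hx) hb (h₂.le hy) hxy.symm
    refine ⟨Subgroup.mul_mem_sup hx ⟨hz₁, hz₂⟩, ?_⟩
    have : z⁻¹ * (z * b) ∈ P₂ ⊔ (F₂.base ⊓ F₁.base) :=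
      mul_mem (inv_mem (Subgroup.mem_sup_right ⟨hz₂, hz₁⟩)) (Subgroup.mem_sup_left hy)
    simpa using this
  refine h.mor_centralProd.2 ⟨sup_le_sup h₁.le h₂.le, g₁, g₂, hg₁.mono ?_, hg₂.mono ?_, ?_⟩
  · rintro a ⟨ha, b, hb, hab⟩
    exact (key a ha b hb hab).1
  · intro b hb
    obtain ⟨hb, a, ha, hab⟩ := h.mem_proj_symm.1 hb
    exact (key a ha b hb hab).2
  · intro a ha b hb hab
    obtain ⟨x, hx, y, hy, hxy⟩ := (h.mem_sup h₁.le h₂.le).1 hab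
    rw [← hxy, hf x hx y hy, ← hgf₁ x hx, ← hgf₂ y hy]
    exact h.mul_apply_eq hg₁ hg₂ (Subgroup.mem_sup_left hx) (key a ha b hb hab).1
      (Subgroup.mem_sup_left hy) (key a ha b hb hab).2 hxy

theorem mul_apply_symm (h : IsCentralPair F₁ F₂) (h₁ : F₁.Mor (h.proj P) f₁)
    (h₂ : F₂.Mor (h.symm.proj P) f₂)
    (hf : ∀ x ∈ F₁.base, ∀ y ∈ F₂.base, x * y ∈ P → f (x * y) = f₁ x * f₂ y) :
    ∀ y ∈ F₂.base, ∀ x ∈ F₁.base, y * x ∈ P → f (y * x) = f₂ y * f₁ x := by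
  intro y hy x hx hxy
  rw [← h.comm x hx y hy] at hxy ⊢
  rw [hf x hx y hy hxy, h.comm _ (h₁.mem ⟨hx, y, hy, hxy⟩) _
    (h₂.mem (h.mem_proj_symm.2 ⟨hy, x, hx, hxy⟩))]

theorem MulMor.symm {h : IsCentralPair F₁ F₂} (hf : h.MulMor P f) : h.symm.MulMor P f := by
  obtain ⟨hP, f₁, f₂, h₁, h₂, hf⟩ := hf
  exact ⟨sup_comm F₁.base F₂.base ▸ hP, f₂, f₁, h₂, h₁, h.mul_apply_symm h₁ h₂ hf⟩

theorem mor_centralProd_symm (h : IsCentralPair F₁ F₂) :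
    h.symm.centralProd.Mor P f ↔ h.centralProd.Mor P f := by
  rw [mor_centralProd, mor_centralProd]
  exact ⟨MulMor.symm, MulMor.symm⟩

theorem left_le_centralProd (h : IsCentralPair F₁ F₂) : F₁ ≤ h.centralProd := by
  refine le_iff_mor.2 ⟨le_sup_left, fun P f hf => ?_⟩
  -- A morphism of `F₁` is paired with the identity of the trivial subgroup of `S₂`.
  refine (h.mor_centralProd_sup (P₂ := ⊥) hf (.id bot_le) ?_).mono le_sup_left
  intro x _ y hy
  obtain rfl := Subgroup.mem_bot.1 hy
  simp

theorem right_le_centralProd (h : IsCentralPair F₁ F₂) : F₂ ≤ h.centralProd := by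
  refine le_iff_mor.2 ⟨le_sup_right, fun P f hf => ?_⟩
  exact h.mor_centralProd_symm.1 ((le_iff_mor.1 h.symm.left_le_centralProd).2 P f hf)

end IsCentralPair

end CentralPairs


/-! ### Saturation via fully automized, receptive conjugates -/

section SaturationCriterion

variable {G : Type*} [Group G] {F : FusionSystem G} {P Q R S : Subgroup G} {p : ℕ}

theorem exists_mor_equiv {e : P ≃* Q} (he : e.toMonoidHom ∈ F.Hom P Q) :
    ∃ f, F.Mor P f ∧ (∀ x : P, (e x : G) = f x) ∧ ∀ y, y ∈ Q ↔ ∃ x ∈ P, f x = y := by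
  obtain ⟨f, hf, h⟩ := exists_mor he
  refine ⟨f, hf, h, fun y => ⟨fun hy => ?_, ?_⟩⟩
  · refine ⟨e.symm ⟨y, hy⟩, (e.symm ⟨y, hy⟩).2, ?_⟩
    rw [← h]
    simp
  · rintro ⟨x, hx, rfl⟩
    rw [← h ⟨x, hx⟩]
    exact (e _).2

theorem isConj_iff : F.IsConj P Q ↔ ∃ f, F.Mor P f ∧ ∀ y, y ∈ Q ↔ ∃ x ∈ P, f x = y := by
  constructor
  · rintro ⟨e, he⟩
    obtain ⟨f, hf, -, h⟩ := exists_mor_equiv he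
    exact ⟨f, hf, h⟩
  · rintro ⟨f, hf, h⟩
    obtain ⟨e, he, -⟩ := hf.exists_equiv h
    exact ⟨e, he⟩

theorem IsConj.refl (hP : P ≤ F.base) : F.IsConj P P :=
  ⟨MulEquiv.refl P, F.inclusion_mem le_rfl hP⟩

theorem IsConj.symm (h : F.IsConj P Q) : F.IsConj Q P := by
  obtain ⟨e, he⟩ := h
  exact ⟨e.symm, (F.exists_equiv_of_mem he Q e fun _ => rfl).2⟩

theorem IsConj.trans (h : F.IsConj P Q) (h' : F.IsConj Q R) : F.IsConj P R := by
  obtain ⟨e, he⟩ := h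
  obtain ⟨e', he'⟩ := h'
  exact ⟨e.trans e', F.comp_mem he he'⟩

theorem IsConj.le (h : F.IsConj P Q) : Q ≤ F.base := F.cod_le h.choose_spec

theorem finite_of_le_base [Finite F.base] (hP : P ≤ F.base) : Finite P :=
  Finite.of_injective _ (Subgroup.inclusion_injective hP)

/-- A conjugate minimizing `N - c` maximizes the bounded function `c`. Used for orders of
normalizers and centralizers. -/
theorem exists_isConj_forall_le (hP : P ≤ F.base) (c : Subgroup G → ℕ) (N : ℕ)
    (hc : ∀ Q, c Q ≤ N) :
    ∃ Q, F.IsConj P Q ∧ ∀ R, F.IsConj Q R → c R ≤ c Q := by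
  obtain ⟨Q, hQ, h⟩ := (measure fun Q : Subgroup G => N - c Q).wf.has_min
    {Q | F.IsConj P Q} ⟨P, .refl hP⟩
  refine ⟨Q, hQ, fun R hR => ?_⟩
  have h1 : ¬ (N - c R < N - c Q) := h R (IsConj.trans hQ hR)
  have := hc Q
  have := hc R
  omega

theorem exists_fullyCentralized [Finite F.base] (hP : P ≤ F.base) :
    ∃ Q, F.IsConj P Q ∧ F.FullyCentralized Q :=
  exists_isConj_forall_le hP _ (Nat.card F.base) fun _ =>
    Nat.card_le_card_of_injective _ (Subgroup.inclusion_injective inf_le_left)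

theorem exists_fullyNormalized [Finite F.base] (hP : P ≤ F.base) :
    ∃ Q, F.IsConj P Q ∧ F.FullyNormalized Q :=
  exists_isConj_forall_le hP _ (Nat.card F.base) fun _ =>
    Nat.card_le_card_of_injective _ (Subgroup.inclusion_injective inf_le_left)

theorem mem_autBase [Finite P] {a : MulAut P} :
    a ∈ autBase S P ↔ ∃ s ∈ S, ∀ x : P, (a x : G) = s * x * s⁻¹ := by
  constructor
  · rintro ⟨⟨s, hs⟩, hsS, rfl⟩
    exact ⟨s, hsS, fun x => rfl⟩
  · rintro ⟨s, hs, h⟩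
    -- For finite `P`, conjugation into `P` already means normalizing `P`.
    have hsn : s ∈ Subgroup.normalizer (P : Set G) :=
      Subgroup.mem_normalizer_fintype fun x hx => by rw [← h ⟨x, hx⟩]; exact (a _).2
    refine ⟨⟨s, hsn⟩, hs, ?_⟩
    ext x
    exact (h x).symm

theorem mem_extensionDomain [Finite P] {e : P ≃* Q} {g : G} :
    g ∈ extensionDomain S e ↔ g ∈ S ∧ (∀ x ∈ P, g * x * g⁻¹ ∈ P) ∧
      ∃ h ∈ S, ∀ x y : P, (y : G) = g * x * g⁻¹ → (e y : G) = h * e x * h⁻¹ := by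
  have : Finite Q := Finite.of_equiv _ e.toEquiv
  constructor
  · rintro ⟨hgS, ⟨⟨g, hg⟩, hgx, rfl⟩⟩
    obtain ⟨h, hh, hx⟩ := mem_autBase.1 hgx
    refine ⟨hgS, fun x hx => (Subgroup.mem_normalizer_iff.1 hg x).1 hx, h, hh, fun x y hxy => ?_⟩
    rw [← hx]
    have : y = P.normalizerMonoidHom ⟨g, hg⟩ x := Subtype.ext hxy
    rw [this]
    simp
  · rintro ⟨hgS, hgP, h, hh, hx⟩
    have hg : g ∈ Subgroup.normalizer (P : Set G) := Subgroup.mem_normalizer_fintype hgP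
    refine ⟨hgS, ⟨⟨g, hg⟩, mem_autBase.2 ⟨h, hh, fun y => ?_⟩, rfl⟩⟩
    have := hx (e.symm y) (P.normalizerMonoidHom ⟨g, hg⟩ (e.symm y)) rfl
    simpa using this

/-- For `g ∈ P`, transporting conjugation by `g` along `e` gives conjugation by `e g`. -/
theorem le_extensionDomain [Finite P] {e : P ≃* Q} (hP : P ≤ S) (hQ : Q ≤ S) :
    P ≤ extensionDomain S e := by
  intro g hg
  refine mem_extensionDomain.2 ⟨hP hg, fun x hx => mul_mem (mul_mem hg hx) (inv_mem hg),
    e ⟨g, hg⟩, hQ (e _).2, fun x y hxy => ?_⟩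
  have : y = ⟨g, hg⟩ * x * ⟨g, hg⟩⁻¹ := Subtype.ext hxy
  rw [this]
  simp

theorem inf_centralizer_le_extensionDomain [Finite P] {e : P ≃* Q} :
    S ⊓ Subgroup.centralizer (P : Set G) ≤ extensionDomain S e := by
  rintro g ⟨hgS, hg⟩
  have key : ∀ x ∈ P, g * x * g⁻¹ = x := fun x hx => by
    rw [← Subgroup.mem_centralizer_iff.1 hg x hx, mul_inv_cancel_right]
  refine mem_extensionDomain.2 ⟨hgS, fun x hx => by rwa [key x hx], 1, one_mem _,
    fun x y hxy => ?_⟩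
  rw [key x x.2] at hxy
  rw [Subtype.ext hxy]
  simp

theorem isPGroup_autBase (hS : IsPGroup p S) : IsPGroup p (autBase S P) :=
  (hS.comap_of_injective (Subgroup.subtype _) (Subgroup.subtype_injective _)).map _

/-- `Aut_S(P)` is a Sylow subgroup of `Aut_F(P)`. -/
def FullyAutomized (p : ℕ) (F : FusionSystem G) (P : Subgroup G) : Prop :=
  ∃ (hP : P ≤ F.base) (A : Sylow p (F.aut P hP)),
    (A : Subgroup (F.aut P hP)) = (autBase F.base P).subgroupOf (F.aut P hP)

/-- Every isomorphism `φ` onto `P` extends to `N_φ`. -/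
def Receptive (F : FusionSystem G) (P : Subgroup G) : Prop :=
  ∀ (Q : Subgroup G) (e : Q ≃* P), e.toMonoidHom ∈ F.Hom Q P →
    ∃ f, F.Mor (extensionDomain F.base e) f ∧ ∀ x : Q, f x = e x

theorem IsSaturated.receptive (hF : F.IsSaturated p) (hP : F.FullyCentralized P) :
    F.Receptive P := by
  intro Q e he
  obtain ⟨ψ, hψ, i, h⟩ := hF.extension Q P e he hP
  obtain ⟨f, hf, hψf⟩ := exists_mor hψ
  exact ⟨f, hf, fun x => (hψf (Subgroup.inclusion i x)).symm.trans (h x)⟩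

/-- A fully normalized conjugate works: the Sylow axiom makes it fully automized and fully
centralized, and the extension axiom then makes it receptive. -/
theorem IsSaturated.exists_fullyAutomized_receptive [Finite F.base] (hF : F.IsSaturated p)
    (hP : P ≤ F.base) : ∃ Q, F.IsConj P Q ∧ F.FullyAutomized p Q ∧ F.Receptive Q := by
  obtain ⟨Q, hPQ, hQ⟩ := exists_fullyNormalized hP
  obtain ⟨h1, A, hA⟩ := hF.sylow Q hPQ.le hQ
  exact ⟨Q, hPQ, ⟨hPQ.le, A, hA⟩, hF.receptive h1⟩

theorem mem_aut {hP : P ≤ F.base} {a : MulAut P} : a ∈ F.aut P hP ↔ a.toMonoidHom ∈ F.Hom P P :=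
  Iff.rfl

theorem congr_mem_aut {hP : P ≤ F.base} {hQ : Q ≤ F.base} {e : P ≃* Q}
    (he : e.toMonoidHom ∈ F.Hom P Q) {a : MulAut P} (ha : a ∈ F.aut P hP) :
    MulAut.congr e a ∈ F.aut Q hQ :=
  F.comp_mem (F.exists_equiv_of_mem he Q e fun _ => rfl).2 (F.comp_mem ha he)

theorem autBase_le_aut [Finite P] {hP : P ≤ F.base} : autBase F.base P ≤ F.aut P hP := by
  intro a ha
  obtain ⟨s, hs, h⟩ := mem_autBase.1 ha
  exact F.conj_mem _ s hP hP hs h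

theorem finite_mulAut [Finite P] : Finite (MulAut P) :=
  Finite.of_injective (fun a : MulAut P => (a : P → P)) DFunLike.coe_injective

/-- Full automization is detected on a conjugate of a Sylow subgroup. -/
theorem fullyAutomized_of_sylow [Fact p.Prime] [Finite F.base] (hS : IsPGroup p F.base)
    {hP : P ≤ F.base} (A : Sylow p (F.aut P hP)) {e : P ≃* Q} (he : e.toMonoidHom ∈ F.Hom P Q)
    (h : ∀ a ∈ A, MulAut.congr e a ∈ autBase F.base Q) : F.FullyAutomized p Q := by
  have hQ : Q ≤ F.base := F.cod_le he
  have : Finite P := finite_of_le_base hP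
  have : Finite (MulAut P) := finite_mulAut
  have he' := (F.exists_equiv_of_mem he Q e fun _ => rfl).2
  let c : F.aut P hP →* F.aut Q hQ :=
    ((MulAut.congr e).toMonoidHom.comp (F.aut P hP).subtype).codRestrict (F.aut Q hQ)
      (fun a => congr_mem_aut he a.2)
  have hc : Function.Surjective c := by
    rintro ⟨b, hb⟩
    refine ⟨⟨MulAut.congr e.symm b, congr_mem_aut he' hb⟩, Subtype.ext ?_⟩
    change MulAut.congr e (MulAut.congr e.symm b) = b
    ext x
    simp
  refine ⟨hQ, A.mapSurjective hc, ?_⟩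
  have hpg : IsPGroup p ((autBase F.base Q).subgroupOf (F.aut Q hQ)) :=
    (isPGroup_autBase hS).comap_of_injective _ (Subgroup.subtype_injective _)
  -- The transported Sylow subgroup lies in the `p`-group `Aut_S(Q)`, so maximality forces equality.
  refine ((A.mapSurjective hc).is_maximal' hpg ?_).symm
  rintro _ ⟨a, ha, rfl⟩
  exact h a ha

/-- Sylow's theorem: a `p`-subgroup lies in some Sylow subgroup, which is conjugate to `Aut_S(P)`.
-/
theorem FullyAutomized.exists_congr_mem [Fact p.Prime] [Finite F.base]
    (h : F.FullyAutomized p P) {hP : P ≤ F.base} (X : Subgroup (F.aut P hP)) (hX : IsPGroup p X) :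
    ∃ c : MulAut P, c ∈ F.aut P hP ∧ ∀ a ∈ X, c * a * c⁻¹ ∈ autBase F.base P := by
  have : Finite P := finite_of_le_base hP
  have : Finite (MulAut P) := finite_mulAut
  obtain ⟨_, A, hA⟩ := h
  obtain ⟨B, hB⟩ := hX.exists_le_sylow
  obtain ⟨c, hc⟩ := MulAction.exists_smul_eq (F.aut P hP) B A
  refine ⟨c, c.2, fun a ha => ?_⟩
  have h1 : c * a * c⁻¹ ∈ (A : Subgroup (F.aut P hP)) := by
    rw [← hc, Sylow.coe_subgroup_smul]
    exact Subgroup.smul_mem_pointwise_smul _ (MulAut.conj c) _ (hB ha)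
  rw [hA] at h1
  exact h1

/-- A normal `p`-subgroup lies in every Sylow subgroup. -/
theorem FullyAutomized.mem_of_normal [Fact p.Prime] [Finite F.base]
    (h : F.FullyAutomized p P) {hP : P ≤ F.base} (N : Subgroup (F.aut P hP)) [N.Normal]
    (hN : IsPGroup p N) {a : F.aut P hP} (ha : a ∈ N) : (a : MulAut P) ∈ autBase F.base P := by
  have : Finite P := finite_of_le_base hP
  have : Finite (MulAut P) := finite_mulAut
  obtain ⟨_, A, hA⟩ := h
  have h1 : a ∈ (A : Subgroup (F.aut P hP)) := hN.le_sylow_of_normal A ha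
  rw [hA] at h1
  exact h1

theorem Mor.map_mem_normalizer {N : Subgroup G} {f : G → G} (hf : F.Mor N f) (hP : P ≤ N)
    [Finite P] (hQ : ∀ y, y ∈ Q ↔ ∃ x ∈ P, f x = y) {g : G} (hgN : g ∈ N)
    (hg : g ∈ Subgroup.normalizer (P : Set G)) : f g ∈ Subgroup.normalizer (Q : Set G) := by
  have hQf : (Q : Set G) = f '' P := Set.ext hQ
  have : Finite (Q : Set G) := by
    rw [hQf]
    exact Set.toFinite (f '' P)
  refine Subgroup.mem_normalizer_fintype ?_
  intro y hy
  obtain ⟨x, hx, rfl⟩ := (hQ y).1 hy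
  refine (hQ _).2 ⟨g * x * g⁻¹, (Subgroup.mem_normalizer_iff.1 hg x).1 hx, ?_⟩
  rw [hf.map_mul (mul_mem hgN (hP hx)) (inv_mem hgN), hf.map_mul hgN (hP hx), hf.map_inv hgN]

theorem Mor.map_mem_centralizer {N : Subgroup G} {f : G → G} (hf : F.Mor N f) (hP : P ≤ N)
    (hQ : ∀ y, y ∈ Q ↔ ∃ x ∈ P, f x = y) {g : G} (hgN : g ∈ N)
    (hg : g ∈ Subgroup.centralizer (P : Set G)) : f g ∈ Subgroup.centralizer (Q : Set G) := by
  rw [Subgroup.mem_centralizer_iff] at *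
  intro y hy
  obtain ⟨x, hx, rfl⟩ := (hQ y).1 hy
  rw [← hf.map_mul (hP hx) hgN, ← hf.map_mul hgN (hP hx), hg x hx]

theorem Mor.card_le {f : G → G} {A B : Subgroup G} [Finite B] (hf : F.Mor A f)
    (hAB : ∀ x ∈ A, f x ∈ B) : Nat.card A ≤ Nat.card B :=
  Nat.card_le_card_of_injective (fun x : A => (⟨f x, hAB x x.2⟩ : B)) fun x y hxy =>
    Subtype.ext (hf.eq_of_eq x.2 y.2 (congrArg Subtype.val hxy))

theorem Mor.exists_of_card_le {f : G → G} {A B : Subgroup G} [Finite A] [Finite B]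
    (hf : F.Mor A f) (hAB : ∀ x ∈ A, f x ∈ B) (hc : Nat.card B ≤ Nat.card A) {y : G}
    (hy : y ∈ B) : ∃ x ∈ A, f x = y := by
  have hinj : Function.Injective (fun x : A => (⟨f x, hAB x x.2⟩ : B)) := fun x y hxy =>
    Subtype.ext (hf.eq_of_eq x.2 y.2 (congrArg Subtype.val hxy))
  obtain ⟨x, hx⟩ := (hinj.bijective_of_nat_card_le hc).2 ⟨y, hy⟩
  exact ⟨x, x.2, congrArg Subtype.val hx⟩

/-- An isomorphism from a conjugate `Q` onto `P` extends to its extension domain, which contains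
`C_S(Q)`; the extension embeds `C_S(Q)` into `C_S(P)`. -/
theorem Receptive.fullyCentralized [Finite F.base] (hP : P ≤ F.base) (h : F.Receptive P) :
    F.FullyCentralized P := by
  intro Q hQ
  have : Finite Q := finite_of_le_base hQ.le
  obtain ⟨e, he⟩ := hQ.symm
  obtain ⟨f, hf, hfe⟩ := h Q e he
  obtain ⟨f', hf', hfe', hP'⟩ := exists_mor_equiv he
  have hQ' : Q ≤ extensionDomain F.base e := le_extensionDomain hQ.le hP
  have : Finite ↥(F.base ⊓ Subgroup.centralizer (P : Set G)) := finite_of_le_base inf_le_left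
  refine (hf.mono inf_centralizer_le_extensionDomain).card_le fun g hg => ?_
  have hge := inf_centralizer_le_extensionDomain (e := e) hg
  refine ⟨hf.mem hge, hf.map_mem_centralizer hQ' (fun y => ?_) hge hg.2⟩
  rw [hP']
  exact exists_congr fun x => and_congr_right fun hx => by rw [hfe ⟨x, hx⟩, ← hfe' ⟨x, hx⟩]

/-- Over a fully automized receptive subgroup, a conjugation extends to the normalizer. -/
theorem exists_mor_normalizer [Fact p.Prime] [Finite F.base] (hS : IsPGroup p F.base)
    (hA : F.FullyAutomized p Q) (hR : F.Receptive Q) (h : F.IsConj P Q) :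
    ∃ f, F.Mor (F.base ⊓ Subgroup.normalizer (P : Set G)) f ∧
      ∀ y, y ∈ Q ↔ ∃ x ∈ P, f x = y := by
  obtain ⟨e, he⟩ := h
  have hP : P ≤ F.base := F.dom_le he
  have hQ : Q ≤ F.base := F.cod_le he
  have : Finite P := finite_of_le_base hP
  have : Finite Q := finite_of_le_base hQ
  -- `X` is `Aut_S(P)` carried to `Q` along `e`, a `p`-group. Some `c` conjugates it into
  -- `Aut_S(Q)`; after following `e` by `c`, the extension domain contains all of `N_S(P)`.
  let X := ((autBase F.base P).map (MulAut.congr e).toMonoidHom).subgroupOf (F.aut Q hQ)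
  have hX : IsPGroup p X :=
    ((isPGroup_autBase hS).map _).comap_of_injective _ (Subgroup.subtype_injective _)
  obtain ⟨c, hc, hcX⟩ := hA.exists_congr_mem X hX
  obtain ⟨f, hf, hfe⟩ := hR P (e.trans c) (F.comp_mem he hc)
  refine ⟨f, hf.mono ?_, fun y => ?_⟩
  · rintro g ⟨hgS, hg⟩
    have ha : P.normalizerMonoidHom ⟨g, hg⟩ ∈ autBase F.base P := ⟨⟨g, hg⟩, hgS, rfl⟩
    obtain ⟨s, hs, hsx⟩ := mem_autBase.1 (hcX ⟨_, congr_mem_aut he (autBase_le_aut (hP := hP) ha)⟩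
      ⟨_, ha, rfl⟩)
    refine mem_extensionDomain.2 ⟨hgS, fun x hx => (Subgroup.mem_normalizer_iff.1 hg x).1 hx,
      s, hs, fun x y hxy => ?_⟩
    have : y = P.normalizerMonoidHom ⟨g, hg⟩ x := Subtype.ext hxy
    rw [← hsx, this]
    simp
  · constructor
    · intro hy
      refine ⟨(e.trans c).symm ⟨y, hy⟩, ((e.trans c).symm ⟨y, hy⟩).2, ?_⟩
      rw [hfe]
      simp
    · rintro ⟨x, hx, rfl⟩
      rw [hfe ⟨x, hx⟩]
      exact ((e.trans c) _).2

/-- A fusion system is saturated if every subgroup is conjugate to a fully automized receptive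
one. -/
theorem isSaturated_of_exists_receptive [Fact p.Prime] [Finite F.base] (hS : IsPGroup p F.base)
    (h : ∀ P ≤ F.base, ∃ Q, F.IsConj P Q ∧ F.FullyAutomized p Q ∧ F.Receptive Q) :
    F.IsSaturated p := by
  have hN : ∀ A : Subgroup G, Finite ↥(F.base ⊓ A) := fun _ => finite_of_le_base inf_le_left
  have hPN : ∀ P ≤ F.base, P ≤ F.base ⊓ Subgroup.normalizer (P : Set G) := fun P hP =>
    le_inf hP Subgroup.le_normalizer
  have hCN : ∀ P : Subgroup G, F.base ⊓ Subgroup.centralizer (P : Set G) ≤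
      F.base ⊓ Subgroup.normalizer (P : Set G) := fun P =>
    inf_le_inf_left _ (Subgroup.centralizer_le_normalizer _)
  constructor
  · intro P hP hPn
    obtain ⟨Q, hPQ, hA, hR⟩ := h P hP
    have : Finite P := finite_of_le_base hP
    have : Finite Q := finite_of_le_base hPQ.le
    obtain ⟨f, hf, hQ⟩ := exists_mor_normalizer hS hA hR hPQ
    have hfN : ∀ x ∈ F.base ⊓ Subgroup.normalizer (P : Set G),
        f x ∈ F.base ⊓ Subgroup.normalizer (Q : Set G) := fun x hx =>
      ⟨hf.mem hx, hf.map_mem_normalizer (hPN P hP) hQ hx hx.2⟩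
    -- As `|N_S(P)|` is maximal, the injection of `N_S(P)` into `N_S(Q)` is onto, so its inverse `g`
    -- is defined on all of `N_S(Q)`.
    have hsurj : ∀ y ∈ F.base ⊓ Subgroup.normalizer (Q : Set G),
        ∃ x ∈ F.base ⊓ Subgroup.normalizer (P : Set G), f x = y := fun y hy =>
      hf.exists_of_card_le hfN (hPn Q hPQ) hy
    obtain ⟨g, hg, hgf, hfg⟩ := hf.exists_inv hsurj
    have hgQ : ∀ x, x ∈ P ↔ ∃ y ∈ Q, g y = x := by
      intro x
      constructor
      · intro hx
        exact ⟨f x, (hQ _).2 ⟨x, hx, rfl⟩, hgf x (hPN P hP hx)⟩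
      · rintro ⟨y, hy, rfl⟩
        obtain ⟨x, hx, rfl⟩ := (hQ y).1 hy
        rwa [hgf x (hPN P hP hx)]
    have hQN := hPN Q hPQ.le
    refine ⟨?_, ?_⟩
    · intro R hR'
      -- `C_S(Q)` has maximal order because `Q` is receptive, and `g` embeds it into `C_S(P)`.
      refine (hR.fullyCentralized hPQ.le R (hPQ.symm.trans hR')).trans ?_
      refine (hg.mono (hCN Q)).card_le fun y hy => ?_
      exact ⟨hg.mem (hCN Q hy), hg.map_mem_centralizer hQN hgQ (hCN Q hy) hy.2⟩
    · obtain ⟨hQb, A, hA⟩ := hA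
      obtain ⟨e, he, hge⟩ := (hg.mono hQN).exists_equiv hgQ
      -- Transporting conjugation by `s ∈ N_S(Q)` along `g` gives conjugation by `g s`, so the Sylow
      -- subgroup `Aut_S(Q)` goes into `Aut_S(P)`.
      obtain ⟨_, B, hB⟩ := fullyAutomized_of_sylow hS A he (by
        intro a ha
        replace ha : a ∈ (A : Subgroup (F.aut Q hQb)) := ha
        rw [hA] at ha
        obtain ⟨⟨s, hsn⟩, hsS, hs⟩ := ha
        have hsN : s ∈ F.base ⊓ Subgroup.normalizer (Q : Set G) := ⟨hsS, hsn⟩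
        refine mem_autBase.2 ⟨g s, hg.mem hsN, fun x => ?_⟩
        obtain ⟨y, rfl⟩ := e.surjective x
        have h1 : ((a : MulAut Q) y : G) = s * y * s⁻¹ := by
          rw [← F.aut Q hQb |>.subtype_apply, ← hs]; rfl
        rw [MulAut.congr_apply]
        simp only [MulEquiv.trans_apply, MulEquiv.symm_apply_apply]
        rw [hge, hge, h1, hg.map_mul (mul_mem hsN (hQN y.2)) (inv_mem hsN),
          hg.map_mul hsN (hQN y.2), hg.map_inv hsN])
      exact ⟨B, hB⟩
  · intro R P e he hPc
    have hP : P ≤ F.base := F.cod_le he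
    have hRb : R ≤ F.base := F.dom_le he
    obtain ⟨Q, hPQ, hA, hR⟩ := h P hP
    have : Finite P := finite_of_le_base hP
    have : Finite Q := finite_of_le_base hPQ.le
    have : Finite R := finite_of_le_base hRb
    obtain ⟨f, hf, hQ⟩ := exists_mor_normalizer hS hA hR hPQ
    obtain ⟨e', he', hfe'⟩ := (hf.mono (hPN P hP)).exists_equiv hQ
    obtain ⟨k, hk, hke⟩ := hR R (e.trans e') (F.comp_mem he he')
    -- `P` is fully centralized, so `f` maps `C_S(P)` onto `C_S(Q)`.
    have hfC : ∀ y ∈ F.base ⊓ Subgroup.centralizer (Q : Set G),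
        ∃ x ∈ F.base ⊓ Subgroup.centralizer (P : Set G), f x = y := fun y hy =>
      (hf.mono (hCN P)).exists_of_card_le
        (fun x hx => Subgroup.mem_inf.2 ⟨hf.mem (hCN P hx),
          hf.map_mem_centralizer (hPN P hP) hQ (hCN P hx) hx.2⟩)
        (hPc Q hPQ) hy
    have hRN : R ≤ extensionDomain F.base e := le_extensionDomain hRb hP
    have hker : ∀ g ∈ extensionDomain F.base e, ∃ s ∈ F.base ⊓ Subgroup.normalizer (P : Set G),
        ∀ x y : R, (y : G) = g * x * g⁻¹ →
          (e.trans e' y : G) = f s * e.trans e' x * (f s)⁻¹ := by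
      intro g hg
      obtain ⟨hgS, hgR, s, hs, hsx⟩ := mem_extensionDomain.1 hg
      have hsN : s ∈ F.base ⊓ Subgroup.normalizer (P : Set G) := by
        refine ⟨hs, Subgroup.mem_normalizer_fintype ?_⟩
        intro x hx
        have := hsx (e.symm ⟨x, hx⟩) ⟨_, hgR _ (e.symm ⟨x, hx⟩).2⟩ rfl
        simp only [MulEquiv.apply_symm_apply] at this
        rw [← this]
        exact (e _).2
      refine ⟨s, hsN, fun x y hxy => ?_⟩
      have hxN := hPN P hP (e x).2
      rw [MulEquiv.trans_apply, MulEquiv.trans_apply, hfe', hfe', hsx x y hxy,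
        hf.map_mul (mul_mem hsN hxN) (inv_mem hsN), hf.map_mul hsN hxN, hf.map_inv hsN]
    have hle : extensionDomain F.base e ≤ extensionDomain F.base (e.trans e') := by
      intro g hg
      obtain ⟨s, hs, h2⟩ := hker g hg
      obtain ⟨hgS, hgR, -⟩ := mem_extensionDomain.1 hg
      exact mem_extensionDomain.2 ⟨hgS, hgR, f s, hf.mem hs, h2⟩
    -- `f s` and `k g` induce the same automorphism of `Q`, so they differ by an element of `C_S(Q)
    -- = f(C_S(P))`. Hence `k g` lies in `f(N_S(P))`, and following `k` by the inverse of `f` gives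
    -- the required extension of `e`.
    have hkf : ∀ g ∈ extensionDomain F.base e,
        ∃ s ∈ F.base ⊓ Subgroup.normalizer (P : Set G), f s = k g := by
      intro g hg
      obtain ⟨s, hs, h2⟩ := hker g hg
      obtain ⟨hgS, hgR, -⟩ := mem_extensionDomain.1 hg
      have hc : (f s)⁻¹ * k g ∈ F.base ⊓ Subgroup.centralizer (Q : Set G) := by
        refine Subgroup.mem_inf.2 ⟨mul_mem (inv_mem (hf.mem hs)) (hk.mem (hle hg)), ?_⟩
        rw [Subgroup.mem_centralizer_iff]
        intro y hy
        obtain ⟨x, hx⟩ := (e.trans e').surjective ⟨y, hy⟩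
        have h3 := h2 x ⟨_, hgR x x.2⟩ rfl
        have hxN := hle (hRN x.2)
        rw [← hke, hk.map_mul (mul_mem (hle hg) hxN) (inv_mem (hle hg)), hk.map_mul (hle hg) hxN,
          hk.map_inv (hle hg), hke, hx] at h3
        have h4 : k g * y * (k g)⁻¹ = f s * y * (f s)⁻¹ := h3
        rw [mul_inv_eq_iff_eq_mul] at h4
        rw [mul_assoc, h4]
        group
      obtain ⟨d, hd, hdx⟩ := hfC _ hc
      refine ⟨s * d, mul_mem hs (hCN P hd), ?_⟩
      rw [hf.map_mul hs (hCN P hd), hdx, mul_inv_cancel_left]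
    obtain ⟨l, hl, hlf, -⟩ := hf.exists_inv (Q := hf.range) fun y hy => hy
    have hlk := (hk.mono hle).comp (Q := hf.range) hkf hl
    obtain ⟨ψ, hψ, hψl⟩ := hlk
    refine ⟨ψ, hψ, hRN, fun x => ?_⟩
    rw [hψl]
    change l (k x) = e x
    rw [hke, MulEquiv.trans_apply, hfe', hlf _ (hPN P hP (e x).2)]

end SaturationCriterion


/-! ### Centrality from saturation, and saturation of the central product -/

section CentralProductSaturation

variable {G : Type*} [Group G] {F F₁ F₂ : FusionSystem G} {P Q R Z : Subgroup G} {p : ℕ}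
  {f f₁ f₂ : G → G}

theorem isCentral_of_mor (hZ : Z ≤ F.base) (hc : ∀ z ∈ Z, ∀ s ∈ F.base, z * s = s * z)
    (h : ∀ P f, F.Mor P f → ∃ g, F.Mor (P ⊔ Z) g ∧ (∀ x ∈ P, g x = f x) ∧ ∀ z ∈ Z, g z = z) :
    F.IsCentral Z := by
  refine (isCentral_iff F Z).2 ⟨hZ, fun s hs => Subgroup.mem_centralizer_iff.2 fun z hz =>
    hc z hz s hs, fun P R φ hφ => ?_⟩
  obtain ⟨f, hf, hφf⟩ := exists_mor hφ
  obtain ⟨g, hg, hgf, hgz⟩ := h P f hf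
  have hgR : ∀ x ∈ P ⊔ Z, g x ∈ R ⊔ Z := by
    intro x hx
    obtain ⟨a, ha, z, hz, rfl⟩ := (mem_sup_of_commute fun a ha z hz =>
      (hc z hz a (hf.le ha)).symm).1 hx
    rw [hg.map_mul (Subgroup.mem_sup_left ha) (Subgroup.mem_sup_right hz), hgz z hz, hgf a ha,
      ← hφf ⟨a, ha⟩]
    exact Subgroup.mul_mem_sup (φ _).2 hz
  obtain ⟨ψ, hψ, hψg⟩ := hg.exists_hom (sup_le (F.cod_le hφ) hZ) hgR
  refine ⟨ψ, hψ, ⟨le_sup_left, fun x => ?_⟩, ⟨le_sup_right, fun z => ?_⟩⟩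
  · rw [hψg, hφf]
    exact hgf x x.2
  · rw [hψg]
    exact hgz z z.2

/-- In a saturated fusion system, a subgroup of the centre of the base group which is fixed
elementwise by all morphisms is central. -/
theorem IsSaturated.isCentral [Finite F.base] (hF : F.IsSaturated p) (hZ : Z ≤ F.base)
    (hc : ∀ z ∈ Z, ∀ s ∈ F.base, z * s = s * z)
    (hfix : ∀ P f, F.Mor P f → ∀ z ∈ P, z ∈ Z → f z = z) : F.IsCentral Z := by
  -- If the target is fully centralized, the extension axiom reaches `P C_S(P)`, hence `P Z`, and
  -- the extension fixes `Z` by hypothesis.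
  have key : ∀ P Q, F.FullyCentralized Q → ∀ g, F.Mor P g → (∀ y, y ∈ Q ↔ ∃ x ∈ P, g x = y) →
      ∃ k, F.Mor (P ⊔ Z) k ∧ (∀ x ∈ P, k x = g x) ∧ ∀ z ∈ Z, k z = z := by
    intro P Q hQ g hg hPQ
    have : Finite P := finite_of_le_base hg.le
    obtain ⟨e, he, heg⟩ := hg.exists_equiv hPQ
    obtain ⟨k, hk, hke⟩ := hF.receptive hQ P e he
    have hle : P ⊔ Z ≤ extensionDomain F.base e := by
      refine sup_le (le_extensionDomain hg.le (F.cod_le he)) fun z hz => ?_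
      refine inf_centralizer_le_extensionDomain ⟨hZ hz, ?_⟩
      exact Subgroup.mem_centralizer_iff.2 fun x hx => (hc z hz x (hg.le hx)).symm
    refine ⟨k, hk.mono hle, fun x hx => ?_, fun z hz => ?_⟩
    · rw [hke ⟨x, hx⟩, heg]
    · exact hfix _ k (hk.mono hle) z (Subgroup.mem_sup_right hz) hz
  refine isCentral_of_mor hZ hc fun P f hf => ?_
  -- In general `P` and its image under `f` both map onto a fully centralized `R`, compatibly with
  -- `f`. Extending both maps to `k` and `l`, the composite of `k` with the inverse of `l` extends
  -- `f`.
  obtain ⟨R, hPR, hR⟩ := exists_fullyCentralized hf.le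
  obtain ⟨g, hg, hgR⟩ := isConj_iff.1 hPR
  obtain ⟨f', hf', hff', hf'f⟩ := hf.exists_inv (Q := hf.range) fun y hy => hy
  obtain ⟨k, hk, hkg, hkz⟩ := key P R hR g hg hgR
  obtain ⟨l, hl, hlg, hlz⟩ := key hf.range R hR _ (hf'.comp (fun y hy => (hf'f y hy).1) hg) (by
    intro y
    rw [hgR]
    constructor
    · rintro ⟨x, hx, rfl⟩
      exact ⟨f x, ⟨x, hx, rfl⟩, by rw [hff' x hx]⟩
    · rintro ⟨_, ⟨x, hx, rfl⟩, rfl⟩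
      exact ⟨x, hx, by rw [hff' x hx]⟩)
  have hlf : ∀ x ∈ P, l (f x) = k x := fun x hx => by
    rw [hlg _ ⟨x, hx, rfl⟩, hff' x hx, hkg x hx]
  obtain ⟨m, hm, hml, -⟩ := hl.exists_inv (Q := hl.range) fun y hy => hy
  have hkl : ∀ x ∈ P ⊔ Z, k x ∈ hl.range := by
    intro x hx
    obtain ⟨a, ha, z, hz, rfl⟩ := (mem_sup_of_commute fun a ha z hz =>
      (hc z hz a (hf.le ha)).symm).1 hx
    have h1 : f a ∈ hf.range ⊔ Z := Subgroup.mem_sup_left ⟨a, ha, rfl⟩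
    have h2 : z ∈ hf.range ⊔ Z := Subgroup.mem_sup_right hz
    refine ⟨f a * z, mul_mem h1 h2, ?_⟩
    rw [hl.map_mul h1 h2, hk.map_mul (Subgroup.mem_sup_left ha) (Subgroup.mem_sup_right hz),
      hlf a ha, hlz z hz, hkz z hz]
  refine ⟨_, hk.comp hkl hm, fun x hx => ?_, fun z hz => ?_⟩
  · rw [← hlf x hx, hml _ (Subgroup.mem_sup_left ⟨x, hx, rfl⟩)]
  · have := hml z (Subgroup.mem_sup_right hz)
    rw [hlz z hz] at this
    rw [hkz z hz, this]

namespace IsCentralPair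

theorem exists_mor_of_proj (h : IsCentralPair F₁ F₂) (hP : P ≤ F₁.base ⊔ F₂.base)
    (h₁ : F₁.Mor (h.proj P) f₁) (h₂ : F₂.Mor (h.symm.proj P) f₂) :
    ∃ f, h.centralProd.Mor P f ∧
      ∀ x ∈ F₁.base, ∀ y ∈ F₂.base, x * y ∈ P → f (x * y) = f₁ x * f₂ y := by
  obtain ⟨f, hf⟩ := h.exists_mul_apply h₁ h₂
  have : ∀ x ∈ F₁.base, ∀ y ∈ F₂.base, x * y ∈ P → f (x * y) = f₁ x * f₂ y :=
    fun x hx y hy hxy => hf x ⟨hx, y, hy, hxy⟩ y (h.mem_proj_symm.2 ⟨hy, x, hx, hxy⟩)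
  exact ⟨f, h.mor_centralProd.2 ⟨hP, f₁, f₂, h₁, h₂, this⟩, this⟩

/-- Projecting commutes with taking images, because a factorization of a value lifts to one of the
argument. So an isomorphism in the central product has components that are isomorphisms between
projections. -/
theorem mem_proj_image (h : IsCentralPair F₁ F₂) (hP : P ≤ F₁.base ⊔ F₂.base)
    (h₁ : F₁.Mor (h.proj P) f₁) (h₂ : F₂.Mor (h.symm.proj P) f₂)
    (hf : ∀ x ∈ F₁.base, ∀ y ∈ F₂.base, x * y ∈ P → f (x * y) = f₁ x * f₂ y)
    (hQ : ∀ y, y ∈ Q ↔ ∃ x ∈ P, f x = y) (a : G) :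
    a ∈ h.proj Q ↔ ∃ x ∈ h.proj P, f₁ x = a := by
  constructor
  · rintro ⟨ha, b, hb, hab⟩
    obtain ⟨q, hq, hqab⟩ := (hQ _).1 hab
    obtain ⟨x, hx, y, hy, rfl, hxa, -⟩ := h.exists_lift h₁ h₂ hf hP hq ha hb hqab
    exact ⟨x, ⟨hx, y, hy, hq⟩, hxa⟩
  · rintro ⟨x, hxP, rfl⟩
    obtain ⟨hx, y, hy, hxy⟩ := id hxP
    refine ⟨h₁.mem hxP, f₂ y, h₂.mem (h.mem_proj_symm.2 ⟨hy, x, hx, hxy⟩), (hQ _).2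
      ⟨x * y, hxy, hf x hx y hy hxy⟩⟩

theorem mem_proj_symm_image (h : IsCentralPair F₁ F₂) (hP : P ≤ F₁.base ⊔ F₂.base)
    (h₁ : F₁.Mor (h.proj P) f₁) (h₂ : F₂.Mor (h.symm.proj P) f₂)
    (hf : ∀ x ∈ F₁.base, ∀ y ∈ F₂.base, x * y ∈ P → f (x * y) = f₁ x * f₂ y)
    (hQ : ∀ y, y ∈ Q ↔ ∃ x ∈ P, f x = y) (b : G) :
    b ∈ h.symm.proj Q ↔ ∃ y ∈ h.symm.proj P, f₂ y = b :=
  h.symm.mem_proj_image (sup_comm F₁.base F₂.base ▸ hP) h₂ h₁ (h.mul_apply_symm h₁ h₂ hf) hQ b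

/-- The triples of automorphisms of the two projections of `P` and of `P` which are compatible
with multiplication. -/
def autTriples (h : IsCentralPair F₁ F₂) (hP : P ≤ h.centralProd.base) :
    Subgroup (F₁.aut (h.proj P) h.proj_le × F₂.aut (h.symm.proj P) h.symm.proj_le ×
      h.centralProd.aut P hP) where
  carrier := {t | ∀ (x : h.proj P) (y : h.symm.proj P) (z : P), (z : G) = x * y ↔
    ((t.2.2 : MulAut P) z : G) = (t.1 : MulAut (h.proj P)) x *
      (t.2.1 : MulAut (h.symm.proj P)) y}
  one_mem' := fun x y z => Iff.rfl
  mul_mem' := fun hs ht x y z => (ht x y z).trans (hs _ _ _)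
  inv_mem' := by
    intro t ht x y z
    have := ht ((t.1 : MulAut (h.proj P))⁻¹ x) ((t.2.1 : MulAut (h.symm.proj P))⁻¹ y)
      ((t.2.2 : MulAut P)⁻¹ z)
    simp only [MulAut.apply_inv_self] at this
    exact this.symm

/-- The components of an automorphism of `P` need not be determined by it, so there is no evident
map from its automorphism group to those of the projections. The triples map to all three, and onto
the automorphisms of `P`. -/
theorem exists_autTriples (h : IsCentralPair F₁ F₂) (hP : P ≤ h.centralProd.base)
    (a : h.centralProd.aut P hP) : ∃ t ∈ h.autTriples hP, t.2.2 = a := by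
  obtain ⟨f, hf, haf, hPf⟩ := exists_mor_equiv (mem_aut.1 a.2)
  obtain ⟨-, f₁, f₂, h₁, h₂, hfm⟩ := h.mor_centralProd.1 hf
  obtain ⟨a₁, ha₁, ha₁f⟩ := h₁.exists_equiv (h.mem_proj_image hP h₁ h₂ hfm hPf)
  obtain ⟨a₂, ha₂, ha₂f⟩ := h₂.exists_equiv (h.mem_proj_symm_image hP h₁ h₂ hfm hPf)
  refine ⟨(⟨a₁, ha₁⟩, ⟨a₂, ha₂⟩, a), fun x y z => ?_, rfl⟩
  have e1 : (((⟨a₁, ha₁⟩ : F₁.aut (h.proj P) h.proj_le) : MulAut (h.proj P)) x : G) = f₁ x :=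
    ha₁f x
  have e2 : (((⟨a₂, ha₂⟩ : F₂.aut (h.symm.proj P) h.symm.proj_le) :
    MulAut (h.symm.proj P)) y : G) = f₂ y := ha₂f y
  dsimp only
  rw [e1, e2, haf]
  constructor
  · intro hz
    rw [hz]
    exact hfm x x.2.1 y y.2.1 (hz ▸ z.2)
  · intro hz
    obtain ⟨x', hx', y', hy', hxy, hfx, hfy⟩ :=
      h.exists_lift h₁ h₂ hfm hP z.2 (h₁.mem x.2) (h₂.mem y.2) hz
    have hz' : x' * y' ∈ P := hxy ▸ z.2
    rw [← hxy, h₁.eq_of_eq ⟨hx', y', hy', hz'⟩ x.2 hfx,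
      h₂.eq_of_eq (h.mem_proj_symm.2 ⟨hy', x', hx', hz'⟩) y.2 hfy]

theorem finite_centralProd_base (h : IsCentralPair F₁ F₂) [Finite F₁.base] [Finite F₂.base] :
    Finite h.centralProd.base := by
  refine Finite.of_surjective (fun x : F₁.base × F₂.base =>
    (⟨x.1 * x.2, Subgroup.mul_mem_sup x.1.2 x.2.2⟩ : ↥(F₁.base ⊔ F₂.base))) ?_
  rintro ⟨x, hx⟩
  obtain ⟨a, ha, b, hb, rfl⟩ := (h.mem_sup le_rfl le_rfl).1 hx
  exact ⟨(⟨a, ha⟩, ⟨b, hb⟩), rfl⟩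

/-- A Sylow subgroup `X` of the triples covers a Sylow subgroup of the automorphisms of `P`. Its
images on the projections can be conjugated into `Aut_{S₁}` and `Aut_{S₂}`, and the two conjugating
automorphisms multiply to a morphism moving `P` to the desired `Q`. -/
theorem exists_fullyAutomized [Fact p.Prime] [Finite F₁.base] [Finite F₂.base]
    (h : IsCentralPair F₁ F₂) (hS : IsPGroup p h.centralProd.base)
    (hP : P ≤ h.centralProd.base) (hA₁ : F₁.FullyAutomized p (h.proj P))
    (hA₂ : F₂.FullyAutomized p (h.symm.proj P)) :
    ∃ Q, h.centralProd.IsConj P Q ∧ h.centralProd.FullyAutomized p Q ∧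
      h.proj Q = h.proj P ∧ h.symm.proj Q = h.symm.proj P := by
  have := h.finite_centralProd_base
  have : Finite P := finite_of_le_base hP
  have : Finite (h.proj P) := finite_of_le_base h.proj_le
  have : Finite (h.symm.proj P) := finite_of_le_base h.symm.proj_le
  have : Finite (MulAut P) := finite_mulAut
  have : Finite (MulAut (h.proj P)) := finite_mulAut
  have : Finite (MulAut (h.symm.proj P)) := finite_mulAut
  let L := h.autTriples hP
  let π₁ : L →* F₁.aut (h.proj P) h.proj_le := (MonoidHom.fst _ _).comp L.subtype
  let π₂ : L →* F₂.aut (h.symm.proj P) h.symm.proj_le :=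
    (MonoidHom.fst _ _).comp ((MonoidHom.snd _ _).comp L.subtype)
  let π : L →* h.centralProd.aut P hP :=
    (MonoidHom.snd _ _).comp ((MonoidHom.snd _ _).comp L.subtype)
  have hπ : Function.Surjective π := fun a => by
    obtain ⟨t, ht, rfl⟩ := h.exists_autTriples hP a
    exact ⟨⟨t, ht⟩, rfl⟩
  let X : Sylow p L := default
  obtain ⟨c₁, hc₁, hX₁⟩ := hA₁.exists_congr_mem _ (X.2.map π₁)
  obtain ⟨c₂, hc₂, hX₂⟩ := hA₂.exists_congr_mem _ (X.2.map π₂)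
  obtain ⟨k₁, hk₁, hck₁, hPk₁⟩ := exists_mor_equiv (mem_aut.1 hc₁)
  obtain ⟨k₂, hk₂, hck₂, hPk₂⟩ := exists_mor_equiv (mem_aut.1 hc₂)
  obtain ⟨k, hk, hkm⟩ := h.exists_mor_of_proj hP hk₁ hk₂
  obtain ⟨e, he, hek⟩ := hk.exists_equiv (Q := hk.range) fun y => hk.mem_range
  refine ⟨hk.range, ⟨e, he⟩, fullyAutomized_of_sylow hS (X.mapSurjective hπ) he ?_, ?_, ?_⟩
  · rintro _ ⟨t, ht, rfl⟩
    have : Finite hk.range := finite_of_le_base hk.range_le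
    obtain ⟨s₁, hs₁, hsx₁⟩ := mem_autBase.1 (hX₁ _ ⟨t, ht, rfl⟩)
    obtain ⟨s₂, hs₂, hsx₂⟩ := mem_autBase.1 (hX₂ _ ⟨t, ht, rfl⟩)
    -- The two conjugated components are conjugation by `s₁` and by `s₂`, so the transported
    -- automorphism is conjugation by the product.
    refine mem_autBase.2 ⟨s₁ * s₂, Subgroup.mul_mem_sup hs₁ hs₂, fun w => ?_⟩
    obtain ⟨z, rfl⟩ := e.surjective w
    obtain ⟨x, hx, y, hy, hxy⟩ := (h.mem_sup h.proj_le h.symm.proj_le).1 (h.le_proj_sup hP z.2)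
    have h1 := (t.2 ⟨x, hx⟩ ⟨y, hy⟩ z).1 hxy.symm
    have h2 := hsx₁ (c₁ ⟨x, hx⟩)
    have h3 := hsx₂ (c₂ ⟨y, hy⟩)
    simp only [MulAut.mul_apply, MulAut.inv_apply_self] at h2 h3
    rw [MulAut.congr_apply]
    simp only [MulEquiv.trans_apply, MulEquiv.symm_apply_apply]
    have h4 : (π t : MulAut P) z = (t.1.2.2 : MulAut P) z := rfl
    rw [hek, hek, h4, h1, hkm _ (h.proj_le (Subtype.property _)) _
      (h.symm.proj_le (Subtype.property _)) (by rw [← h1]; exact Subtype.property _), ← hxy,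
      hkm x (h.proj_le hx) y (h.symm.proj_le hy) (by rw [hxy]; exact z.2), ← hck₁, ← hck₂,
      ← hck₁ ⟨x, hx⟩, ← hck₂ ⟨y, hy⟩]
    refine (congrArg₂ (· * ·) h2 h3).trans ?_
    rw [h.mul_mul_mul_comm hs₂ (h.proj_le (Subtype.property _)), h.comm s₁ hs₁ s₂ hs₂,
      mul_inv_rev, h.mul_mul_mul_comm (mul_mem hs₂ (h.symm.proj_le (Subtype.property _)))
      (inv_mem hs₁)]
  -- The projections are unchanged because `c₁` and `c₂` are automorphisms of them.
  · ext a
    rw [h.mem_proj_image hP hk₁ hk₂ hkm (fun y => hk.mem_range), hPk₁]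
  · ext a
    rw [h.mem_proj_symm_image hP hk₁ hk₂ hkm (fun y => hk.mem_range), hPk₂]

/-- The automorphisms in `F₁` which act trivially modulo `S₁ ∩ S₂`. -/
def autKernel (_h : IsCentralPair F₁ F₂) (hP : P ≤ F₁.base) : Subgroup (F₁.aut P hP) where
  carrier := {n | ∀ y : P, ((n : MulAut P) y : G) * (y : G)⁻¹ ∈ F₂.base}
  one_mem' := fun y => by simp
  mul_mem' := by
    intro n m hn hm y
    have := mul_mem (hn ((m : MulAut P) y)) (hm y)
    simpa [mul_assoc] using this
  inv_mem' := by
    intro n hn y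
    have := inv_mem (hn ((n : MulAut P)⁻¹ y))
    simpa using this

/-- The displacement `n w * w⁻¹` lies in `S₁ ∩ S₂`, so `m` fixes it; it is therefore also the
displacement of `m w` under the conjugate of `n` by `m`. -/
instance autKernel_normal (h : IsCentralPair F₁ F₂) (hP : P ≤ F₁.base) :
    (h.autKernel hP).Normal where
  conj_mem := by
    intro n hn m y
    obtain ⟨w, rfl⟩ := (m : MulAut P).surjective y
    obtain ⟨f, hf, hmf, -⟩ := exists_mor_equiv (mem_aut.1 m.2)
    have hz := hn w
    have hzP : ((n : MulAut P) w : G) * (w : G)⁻¹ ∈ P := mul_mem (Subtype.property _)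
      (inv_mem w.2)
    have := h.apply_left hf hzP (hP hzP) hz
    rw [hf.map_mul (Subtype.property _) (inv_mem w.2), hf.map_inv w.2, ← hmf, ← hmf] at this
    have h2 : ((m * n * m⁻¹ : F₁.aut P hP) : MulAut P) ((m : MulAut P) w) =
        (m : MulAut P) ((n : MulAut P) w) := by simp
    rw [h2]
    rw [← this] at hz
    exact hz

/-- If `n y = z * y` with `z ∈ S₁ ∩ S₂`, then `n` fixes `z`, so its `k`-th power sends `y` to `z ^ k
* y`. The order of `S₁` kills every `z`. -/
theorem isPGroup_autKernel [Fact p.Prime] [Finite F₁.base] (h : IsCentralPair F₁ F₂)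
    (hS : IsPGroup p F₁.base) (hP : P ≤ F₁.base) : IsPGroup p (h.autKernel hP) := by
  obtain ⟨m, hm⟩ := IsPGroup.iff_card.1 hS
  rintro ⟨n, hn⟩
  refine ⟨m, Subtype.ext (Subtype.ext (MulEquiv.ext fun y => ?_))⟩
  obtain ⟨f, hf, hnf, -⟩ := exists_mor_equiv (mem_aut.1 n.2)
  have hz := hn y
  obtain ⟨z, hzdef⟩ : ∃ z, z = ((n : MulAut P) y : G) * (y : G)⁻¹ := ⟨_, rfl⟩
  rw [← hzdef] at hz
  have hzP : z ∈ P := hzdef ▸ mul_mem (Subtype.property _) (inv_mem y.2)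
  have hpow : ∀ k : ℕ, (((n : MulAut P) ^ k) y : G) = z ^ k * y := by
    intro k
    induction k with
    | zero => simp
    | succ k ih =>
      have h1 : ((n : MulAut P) ^ (k + 1)) y = (n : MulAut P) (((n : MulAut P) ^ k) y) := by
        rw [pow_succ', MulAut.mul_apply]
      have h2 : ((n : MulAut P) y : G) = z * y := by simp [hzdef]
      have h3 : f (z ^ k) = z ^ k :=
        h.apply_left hf (pow_mem hzP k) (hP (pow_mem hzP k)) (pow_mem hz k)
      have h4 : ((n : MulAut P) (((n : MulAut P) ^ k) y) : G) = f (((n : MulAut P) ^ k) y : G) :=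
        hnf _
      have h5 : ((n : MulAut P) y : G) = f y := hnf _
      rw [h1, h4, ih, hf.map_mul (pow_mem hzP k) y.2, h3, ← h5, h2, pow_succ, mul_assoc]
  have h1 : z ^ p ^ m = 1 := by
    have := pow_card_eq_one' (x := (⟨z, hP hzP⟩ : F₁.base))
    rw [hm] at this
    exact congrArg Subtype.val this
  have h2 := hpow (p ^ m)
  rw [h1, one_mul] at h2
  exact Subtype.ext h2

/-- The first factor of an element of `N_φ` lies in `N_φ₁`. -/
theorem mem_extensionDomain_proj [Fact p.Prime] [Finite F₁.base] (h : IsCentralPair F₁ F₂)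
    (hS : IsPGroup p F₁.base) (hA : F₁.FullyAutomized p (h.proj Q))
    (h₁ : F₁.Mor (h.proj R) f₁) (h₂ : F₂.Mor (h.symm.proj R) f₂)
    (hf : ∀ x ∈ F₁.base, ∀ y ∈ F₂.base, x * y ∈ R → f (x * y) = f₁ x * f₂ y)
    (hfQ : ∀ x ∈ R, f x ∈ Q) {e : h.proj R ≃* h.proj Q}
    (he : e.toMonoidHom ∈ F₁.Hom (h.proj R) (h.proj Q)) (hef : ∀ x : h.proj R, (e x : G) = f₁ x)
    {g₁ g₂ s₁ s₂ : G} (hg₁ : g₁ ∈ F₁.base) (hg₂ : g₂ ∈ F₂.base) (hs₁ : s₁ ∈ F₁.base)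
    (hs₂ : s₂ ∈ F₂.base) (hgR : ∀ x ∈ R, g₁ * g₂ * x * (g₁ * g₂)⁻¹ ∈ R)
    (hgs : ∀ x ∈ R, f (g₁ * g₂ * x * (g₁ * g₂)⁻¹) = s₁ * s₂ * f x * (s₁ * s₂)⁻¹) :
    g₁ ∈ extensionDomain F₁.base e := by
  have : Finite (h.proj R) := finite_of_le_base h.proj_le
  have : Finite (h.proj Q) := finite_of_le_base h.proj_le
  have hconj : ∀ {a b c d : G}, a ∈ F₁.base → b ∈ F₂.base → c ∈ F₁.base → d ∈ F₂.base →
      a * b * (c * d) * (a * b)⁻¹ = a * c * a⁻¹ * (b * d * b⁻¹) := by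
    intro a b c d ha hb hc hd
    rw [h.mul_mul_mul_comm hb hc, h.comm a ha b hb, mul_inv_rev,
      h.mul_mul_mul_comm (mul_mem hb hd) (inv_mem ha)]
  -- Choosing `y` with `x * y ∈ R` and factoring `hgs` at `x * y` in two ways shows that its
  -- `S₁`-parts agree only modulo `S₁ ∩ S₂`.
  have key : ∀ x ∈ h.proj R, g₁ * x * g₁⁻¹ ∈ h.proj R ∧ s₁ * f₁ x * s₁⁻¹ ∈ h.proj Q ∧
      f₁ (g₁ * x * g₁⁻¹) * (s₁ * f₁ x * s₁⁻¹)⁻¹ ∈ F₂.base := by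
    intro x hxR
    obtain ⟨hx, y, hy, hxy⟩ := id hxR
    have hyR : y ∈ h.symm.proj R := h.mem_proj_symm.2 ⟨hy, x, hx, hxy⟩
    have hx' : g₁ * x * g₁⁻¹ ∈ F₁.base := mul_mem (mul_mem hg₁ hx) (inv_mem hg₁)
    have hy' : g₂ * y * g₂⁻¹ ∈ F₂.base := mul_mem (mul_mem hg₂ hy) (inv_mem hg₂)
    have hsx : s₁ * f₁ x * s₁⁻¹ ∈ F₁.base := mul_mem (mul_mem hs₁ (h₁.mem hxR)) (inv_mem hs₁)
    have hsy : s₂ * f₂ y * s₂⁻¹ ∈ F₂.base := mul_mem (mul_mem hs₂ (h₂.mem hyR)) (inv_mem hs₂)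
    have a1 := hgR _ hxy
    have a2 := hgs _ hxy
    have a3 := hfQ _ a1
    rw [a2] at a3
    rw [hconj hg₁ hg₂ hx hy] at a1 a2
    rw [hf x hx y hy hxy, hconj hs₁ hs₂ (h₁.mem hxR) (h₂.mem hyR)] at a2 a3
    rw [hf _ hx' _ hy' a1] at a2
    have hxR' : g₁ * x * g₁⁻¹ ∈ h.proj R := ⟨hx', _, hy', a1⟩
    obtain ⟨z, hz₁, hz₂, hz, -⟩ := h.exists_of_mul_eq_mul (h₁.mem hxR') hsx
      (h₂.mem (h.mem_proj_symm.2 ⟨hy', _, hx', a1⟩)) hsy a2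
    refine ⟨hxR', ⟨hsx, _, hsy, a3⟩, ?_⟩
    rw [hz, h.comm _ hsx z hz₂, mul_inv_cancel_right]
    exact hz₂
  have hgN : g₁ ∈ Subgroup.normalizer (h.proj R : Set G) :=
    Subgroup.mem_normalizer_fintype fun x hx => (key x hx).1
  have hsN : s₁ ∈ Subgroup.normalizer (h.proj Q : Set G) :=
    Subgroup.mem_normalizer_fintype fun x hx => by
      obtain ⟨y, hy⟩ := e.surjective ⟨x, hx⟩
      have : x = f₁ y := by rw [← hef, hy]
      rw [this]
      exact (key y y.2).2.1
  have ha : (h.proj R).normalizerMonoidHom ⟨g₁, hgN⟩ ∈ autBase F₁.base (h.proj R) :=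
    ⟨⟨g₁, hgN⟩, hg₁, rfl⟩
  have hb : (h.proj Q).normalizerMonoidHom ⟨s₁, hsN⟩ ∈ autBase F₁.base (h.proj Q) :=
    ⟨⟨s₁, hsN⟩, hs₁, rfl⟩
  set a := (h.proj R).normalizerMonoidHom ⟨g₁, hgN⟩
  set b := (h.proj Q).normalizerMonoidHom ⟨s₁, hsN⟩
  have hag : ∀ x : h.proj R, (a x : G) = g₁ * x * g₁⁻¹ := fun _ => rfl
  have hbs : ∀ x : h.proj Q, (b x : G) = s₁ * x * s₁⁻¹ := fun _ => rfl
  have hn : MulAut.congr e a * b⁻¹ ∈ F₁.aut (h.proj Q) h.proj_le :=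
    mul_mem (congr_mem_aut he (autBase_le_aut (hP := h.proj_le) ha)) (inv_mem (autBase_le_aut hb))
  -- Conjugation by `g₁`, transported along `e`, equals conjugation by `s₁` up to an element of
  -- `autKernel`. This normal `p`-subgroup lies in `Aut_{S₁}` by full automization, so the error is
  -- itself induced by an element of `S₁`.
  have hnk : (⟨_, hn⟩ : F₁.aut (h.proj Q) h.proj_le) ∈ h.autKernel h.proj_le := by
    intro y
    obtain ⟨w, rfl⟩ := b.surjective y
    obtain ⟨x, rfl⟩ := e.surjective w
    have h1 : (MulAut.congr e a * b⁻¹) (b (e x)) = e (a x) := by simp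
    have h2 := (key x x.2).2.2
    rw [← hag, ← hef, ← hef, ← hbs] at h2
    change (((MulAut.congr e a * b⁻¹) (b (e x)) : h.proj Q) : G) * _ ∈ _
    rw [h1]
    exact h2
  have hab : MulAut.congr e a ∈ autBase F₁.base (h.proj Q) := by
    have := mul_mem (hA.mem_of_normal _ (h.isPGroup_autKernel hS h.proj_le) hnk) hb
    simpa using this
  obtain ⟨s, hs, hsx⟩ := mem_autBase.1 hab
  refine mem_extensionDomain.2 ⟨hg₁, fun x hx => (key x hx).1, s, hs, fun x y hxy => ?_⟩
  have : y = a x := Subtype.ext hxy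
  rw [this, ← hsx]
  simp

/-- Receptivity of the projections extends the components of `e` to their own extension domains. The
product map is defined on the product of these domains, which contains the extension domain of `e`.
-/
theorem receptive_centralProd [Fact p.Prime] [Finite F₁.base] [Finite F₂.base]
    (h : IsCentralPair F₁ F₂) (hS₁ : IsPGroup p F₁.base) (hS₂ : IsPGroup p F₂.base)
    (hA₁ : F₁.FullyAutomized p (h.proj Q)) (hA₂ : F₂.FullyAutomized p (h.symm.proj Q))
    (hR₁ : F₁.Receptive (h.proj Q)) (hR₂ : F₂.Receptive (h.symm.proj Q)) :
    h.centralProd.Receptive Q := by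
  intro R e he
  have := h.finite_centralProd_base
  have hRb : R ≤ F₁.base ⊔ F₂.base := h.centralProd.dom_le he
  have : Finite R := finite_of_le_base (F := h.centralProd) hRb
  have : Finite (h.proj R) := finite_of_le_base h.proj_le
  have : Finite (h.symm.proj R) := finite_of_le_base h.symm.proj_le
  obtain ⟨f, hf, hef, hRQ⟩ := exists_mor_equiv he
  obtain ⟨-, f₁, f₂, h₁, h₂, hfm⟩ := h.mor_centralProd.1 hf
  obtain ⟨e₁, he₁, hef₁⟩ := h₁.exists_equiv (h.mem_proj_image hRb h₁ h₂ hfm hRQ)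
  obtain ⟨e₂, he₂, hef₂⟩ := h₂.exists_equiv (h.mem_proj_symm_image hRb h₁ h₂ hfm hRQ)
  obtain ⟨k₁, hk₁, hke₁⟩ := hR₁ _ e₁ he₁
  obtain ⟨k₂, hk₂, hke₂⟩ := hR₂ _ e₂ he₂
  obtain ⟨k, hk⟩ := h.exists_mul_apply hk₁ hk₂
  have hfQ : ∀ x ∈ R, f x ∈ Q := fun x hx => (hRQ _).2 ⟨x, hx, rfl⟩
  refine ⟨k, (h.mor_centralProd_sup hk₁ hk₂ hk).mono ?_, fun z => ?_⟩
  · intro g hg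
    obtain ⟨hgS, hgR, s, hs, hgs⟩ := mem_extensionDomain.1 hg
    obtain ⟨g₁, hg₁, g₂, hg₂, rfl⟩ := (h.mem_sup le_rfl le_rfl).1 hgS
    obtain ⟨s₁, hs₁, s₂, hs₂, rfl⟩ := (h.mem_sup le_rfl le_rfl).1 hs
    have hgs' : ∀ x ∈ R, f (g₁ * g₂ * x * (g₁ * g₂)⁻¹) = s₁ * s₂ * f x * (s₁ * s₂)⁻¹ := by
      intro x hx
      have := hgs ⟨x, hx⟩ ⟨_, hgR x hx⟩ rfl
      rwa [hef, hef] at this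
    refine Subgroup.mul_mem_sup
      (h.mem_extensionDomain_proj hS₁ hA₁ h₁ h₂ hfm hfQ he₁ hef₁ hg₁ hg₂ hs₁ hs₂ hgR hgs') ?_
    rw [h.comm g₁ hg₁ g₂ hg₂] at hgR hgs'
    rw [h.comm s₁ hs₁ s₂ hs₂] at hgs'
    exact h.symm.mem_extensionDomain_proj hS₂ hA₂ h₂ h₁ (h.mul_apply_symm h₁ h₂ hfm) hfQ he₂
      hef₂ hg₂ hg₁ hs₂ hs₁ hgR hgs'
  · obtain ⟨x, hx, y, hy, hxy⟩ := (h.mem_sup h.proj_le h.symm.proj_le).1 (h.le_proj_sup hRb z.2)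
    have hx' := le_extensionDomain (e := e₁) h.proj_le h.proj_le hx
    have hy' := le_extensionDomain (e := e₂) h.symm.proj_le h.symm.proj_le hy
    rw [hef, ← hxy, hk x hx' y hy', hfm x (h.proj_le hx) y (h.symm.proj_le hy)
      (by rw [hxy]; exact z.2), hke₁ ⟨x, hx⟩, hke₂ ⟨y, hy⟩, hef₁, hef₂]

theorem isSaturated_centralProd [Fact p.Prime] [Finite F₁.base] [Finite F₂.base]
    (h : IsCentralPair F₁ F₂) (hS : IsPGroup p h.centralProd.base) (sat₁ : F₁.IsSaturated p)
    (sat₂ : F₂.IsSaturated p) : h.centralProd.IsSaturated p := by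
  have := h.finite_centralProd_base
  have hS₁ : IsPGroup p F₁.base := hS.to_le le_sup_left
  have hS₂ : IsPGroup p F₂.base := hS.to_le le_sup_right
  refine isSaturated_of_exists_receptive hS fun P hP => ?_
  obtain ⟨Q₁, hQ₁, hA₁, hR₁⟩ := sat₁.exists_fullyAutomized_receptive (h.proj_le (P := P))
  obtain ⟨Q₂, hQ₂, hA₂, hR₂⟩ := sat₂.exists_fullyAutomized_receptive (h.symm.proj_le (P := P))
  obtain ⟨f₁, h₁, hf₁⟩ := isConj_iff.1 hQ₁
  obtain ⟨f₂, h₂, hf₂⟩ := isConj_iff.1 hQ₂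
  obtain ⟨f, hf, hfm⟩ := h.exists_mor_of_proj hP h₁ h₂
  have hPQ : h.centralProd.IsConj P hf.range := isConj_iff.2 ⟨f, hf, fun y => hf.mem_range⟩
  have e₁ : h.proj hf.range = Q₁ := by
    ext a
    rw [h.mem_proj_image hP h₁ h₂ hfm (fun y => hf.mem_range), hf₁]
  have e₂ : h.symm.proj hf.range = Q₂ := by
    ext a
    rw [h.mem_proj_symm_image hP h₁ h₂ hfm (fun y => hf.mem_range), hf₂]
  rw [← e₁] at hA₁ hR₁
  rw [← e₂] at hA₂ hR₂
  -- This second move preserves both projections, so their full automization and receptivity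
  -- survive.
  obtain ⟨Q, hQ, hA, i₁, i₂⟩ := h.exists_fullyAutomized hS hf.range_le hA₁ hA₂
  rw [← i₁] at hA₁ hR₁
  rw [← i₂] at hA₂ hR₂
  exact ⟨Q, hPQ.trans hQ, hA, h.receptive_centralProd hS₁ hS₂ hA₁ hA₂ hR₁ hR₂⟩

end IsCentralPair

end CentralProductSaturation


/-! ### Morphisms of the direct product -/

section DirectProducts

variable {G₁ G₂ : Type*} [Group G₁] [Group G₂] {F₁ : FusionSystem G₁} {F₂ : FusionSystem G₂}
  {P Q : Subgroup (G₁ × G₂)} {f g : G₁ × G₂ → G₁ × G₂}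

/-- The functions whose restrictions to `P` are the morphisms of `F₁ × F₂`. -/
def ProdMor (F₁ : FusionSystem G₁) (F₂ : FusionSystem G₂) (P : Subgroup (G₁ × G₂))
    (f : G₁ × G₂ → G₁ × G₂) : Prop :=
  ∃ f₁ f₂, F₁.Mor (P.map (MonoidHom.fst G₁ G₂)) f₁ ∧ F₂.Mor (P.map (MonoidHom.snd G₁ G₂)) f₂ ∧
    ∀ x ∈ P, f x = (f₁ x.1, f₂ x.2)

theorem fst_mem_map {x : G₁ × G₂} (hx : x ∈ P) : x.1 ∈ P.map (MonoidHom.fst G₁ G₂) :=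
  Subgroup.mem_map_of_mem (MonoidHom.fst G₁ G₂) hx

theorem snd_mem_map {x : G₁ × G₂} (hx : x ∈ P) : x.2 ∈ P.map (MonoidHom.snd G₁ G₂) :=
  Subgroup.mem_map_of_mem (MonoidHom.snd G₁ G₂) hx

namespace ProdMor

theorem le (hf : ProdMor F₁ F₂ P f) : P ≤ F₁.base.prod F₂.base := by
  obtain ⟨f₁, f₂, h₁, h₂, -⟩ := hf
  exact fun x hx => ⟨h₁.le (fst_mem_map hx), h₂.le (snd_mem_map hx)⟩

theorem congr (hf : ProdMor F₁ F₂ P f) (hfg : ∀ x ∈ P, f x = g x) : ProdMor F₁ F₂ P g := by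
  obtain ⟨f₁, f₂, h₁, h₂, h⟩ := hf
  exact ⟨f₁, f₂, h₁, h₂, fun x hx => (hfg x hx).symm.trans (h x hx)⟩

theorem injOn (hf : ProdMor F₁ F₂ P f) : Set.InjOn f P := by
  obtain ⟨f₁, f₂, h₁, h₂, h⟩ := hf
  intro x hx y hy hxy
  rw [h x hx, h y hy, Prod.mk.injEq] at hxy
  exact Prod.ext (h₁.eq_of_eq (fst_mem_map hx) (fst_mem_map hy) hxy.1)
    (h₂.eq_of_eq (snd_mem_map hx) (snd_mem_map hy) hxy.2)

theorem conj (hP : P ≤ F₁.base.prod F₂.base) {s : G₁ × G₂} (hs : s ∈ F₁.base.prod F₂.base) :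
    ProdMor F₁ F₂ P (fun x => s * x * s⁻¹) := by
  refine ⟨_, _, .conj ?_ hs.1, .conj ?_ hs.2, fun x _ => rfl⟩
  · rintro _ ⟨x, hx, rfl⟩
    exact (hP hx).1
  · rintro _ ⟨x, hx, rfl⟩
    exact (hP hx).2

theorem comp (hf : ProdMor F₁ F₂ P f) (hfQ : ∀ x ∈ P, f x ∈ Q) (hg : ProdMor F₁ F₂ Q g) :
    ProdMor F₁ F₂ P (fun x => g (f x)) := by
  obtain ⟨f₁, f₂, h₁, h₂, h⟩ := hf
  obtain ⟨g₁, g₂, k₁, k₂, k⟩ := hg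
  refine ⟨_, _, h₁.comp ?_ k₁, h₂.comp ?_ k₂, fun x hx => ?_⟩
  · rintro _ ⟨x, hx, rfl⟩
    exact ⟨f x, hfQ x hx, congrArg Prod.fst (h x hx)⟩
  · rintro _ ⟨x, hx, rfl⟩
    exact ⟨f x, hfQ x hx, congrArg Prod.snd (h x hx)⟩
  · beta_reduce
    rw [k _ (hfQ x hx), h x hx]

theorem inv (hf : ProdMor F₁ F₂ P f) (hQ : ∀ y, y ∈ Q ↔ ∃ x ∈ P, f x = y)
    (hg : ∀ x ∈ P, g (f x) = x) : ProdMor F₁ F₂ Q g := by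
  obtain ⟨f₁, f₂, h₁, h₂, h⟩ := hf
  obtain ⟨g₁, k₁, hg₁, -⟩ := h₁.exists_inv (Q := Q.map (MonoidHom.fst G₁ G₂)) (by
    rintro _ ⟨y, hy, rfl⟩
    obtain ⟨x, hx, rfl⟩ := (hQ y).1 hy
    exact ⟨x.1, fst_mem_map hx, (congrArg Prod.fst (h x hx)).symm⟩)
  obtain ⟨g₂, k₂, hg₂, -⟩ := h₂.exists_inv (Q := Q.map (MonoidHom.snd G₁ G₂)) (by
    rintro _ ⟨y, hy, rfl⟩
    obtain ⟨x, hx, rfl⟩ := (hQ y).1 hy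
    exact ⟨x.2, snd_mem_map hx, (congrArg Prod.snd (h x hx)).symm⟩)
  refine ⟨g₁, g₂, k₁, k₂, fun y hy => ?_⟩
  obtain ⟨x, hx, rfl⟩ := (hQ y).1 hy
  rw [hg x hx, h x hx]
  exact Prod.ext (hg₁ _ (fst_mem_map hx)).symm (hg₂ _ (snd_mem_map hx)).symm

end ProdMor

/-- Maps satisfying `ProdMor` form a fusion system containing the generators, so minimality gives
one direction. Conversely, such a map is the restriction of a generator from the product of the two
projections of `P`. -/
theorem mor_prod : (F₁.prod F₂).Mor P f ↔ ProdMor F₁ F₂ P f := by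
  constructor
  · rintro ⟨φ, ⟨-, -, -, hφ⟩, hφf⟩
    have := hφ (ofMor (F₁.base.prod F₂.base) (ProdMor F₁ F₂) ProdMor.le ProdMor.injOn
      (fun hP hs => ProdMor.conj hP hs) ProdMor.comp (fun hf hQ hg _ => hf.inv hQ hg)) rfl (by
        rintro _ _ _ ⟨φ₁, φ₂, h₁, h₂⟩
        obtain ⟨f₁, hf₁, e₁⟩ := exists_mor h₁
        obtain ⟨f₂, hf₂, e₂⟩ := exists_mor h₂
        refine ⟨Subgroup.prod_mono (F₁.cod_le h₁) (F₂.cod_le h₂), fun x => (f₁ x.1, f₂ x.2),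
          ⟨f₁, f₂, hf₁.mono ?_, hf₂.mono ?_, fun _ _ => rfl⟩, fun x => ?_⟩
        · rintro _ ⟨x, hx, rfl⟩
          exact hx.1
        · rintro _ ⟨x, hx, rfl⟩
          exact hx.2
        · exact Prod.ext (e₁ ⟨x.1.1, x.2.1⟩) (e₂ ⟨x.1.2, x.2.2⟩))
    obtain ⟨-, k, hk, hφk⟩ := this
    exact hk.congr fun x hx => (hφk ⟨x, hx⟩).symm.trans (hφf ⟨x, hx⟩)
  · rintro ⟨f₁, f₂, ⟨φ₁, hφ₁, e₁⟩, ⟨φ₂, hφ₂, e₂⟩, h⟩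
    have hmem : prodHom φ₁ φ₂ ∈ (F₁.prod F₂).Hom _ _ := by
      refine ⟨Subgroup.prod_mono (F₁.dom_le hφ₁) (F₂.dom_le hφ₂), le_rfl, ?_,
        fun E _ hC => hC _ _ (.mk φ₁ φ₂ hφ₁ hφ₂)⟩
      intro x y hxy
      have hxy' := congrArg Subtype.val hxy
      have a₁ := F₁.injective hφ₁ (Subtype.ext (congrArg Prod.fst hxy'))
      have a₂ := F₂.injective hφ₂ (Subtype.ext (congrArg Prod.snd hxy'))
      exact Subtype.ext (Prod.ext (congrArg Subtype.val a₁) (congrArg Subtype.val a₂))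
    have hmor : (F₁.prod F₂).Mor _ (fun x => (f₁ x.1, f₂ x.2)) :=
      mor_of_mem hmem fun x => Prod.ext (e₁ ⟨x.1.1, x.2.1⟩) (e₂ ⟨x.1.2, x.2.2⟩)
    exact (hmor.mono fun x hx => ⟨fst_mem_map hx, snd_mem_map hx⟩).congr fun x hx => (h x hx).symm

end DirectProducts

/-! ### Mutual centralization and central products -/

section CentralProductCharacterization

variable {G : Type*} [Group G] {F F₁ F₂ D : FusionSystem G} {p : ℕ}

theorem le_centralizer_iff {X : Subgroup G} (hX : X ≤ F.base) (h₁ : F₁ ≤ F) :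
    F₁ ≤ F.centralizer X hX ↔ (∀ s ∈ F₁.base, ∀ x ∈ X, s * x = x * s) ∧
      ∀ P f, F₁.Mor P f → ∃ g, F.Mor (P ⊔ X) g ∧ (∀ x ∈ P, g x = f x) ∧ ∀ x ∈ X, g x = x := by
  constructor
  · rintro ⟨hb, h⟩
    refine ⟨fun s hs x hx => (Subgroup.mem_centralizer_iff.1 (hb hs).2 x hx).symm, ?_⟩
    rintro P f ⟨φ, hφ, hf⟩
    obtain ⟨-, -, -, ψ, hψ, ⟨i, hi⟩, ⟨j, hj⟩⟩ := h _ _ hφ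
    obtain ⟨g, hg, hψg⟩ := exists_mor hψ
    exact ⟨g, hg, fun x hx => (hψg ⟨x, i hx⟩).symm.trans ((hi ⟨x, hx⟩).trans (hf ⟨x, hx⟩)),
      fun x hx => (hψg ⟨x, j hx⟩).symm.trans (hj ⟨x, hx⟩)⟩
  · rintro ⟨hc, h⟩
    have hb : F₁.base ≤ F.base ⊓ Subgroup.centralizer (X : Set G) := fun s hs =>
      Subgroup.mem_inf.2 ⟨h₁.1 hs, Subgroup.mem_centralizer_iff.2 fun x hx => (hc s hs x hx).symm⟩
    refine ⟨hb, fun P Q φ hφ => ?_⟩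
    obtain ⟨f, hf, hφf⟩ := exists_mor hφ
    obtain ⟨g, hg, hgf, hgx⟩ := h P f hf
    have hQ := F₁.cod_le hφ
    obtain ⟨ψ, hψ, hψg⟩ := hg.exists_hom (Q := Q ⊔ X) (sup_le (hQ.trans h₁.1) hX) (by
      intro x hx
      obtain ⟨a, ha, b, hb, rfl⟩ := (mem_sup_of_commute fun a ha b hb =>
        hc a (hf.le ha) b hb).1 hx
      rw [hg.map_mul (Subgroup.mem_sup_left ha) (Subgroup.mem_sup_right hb), hgf a ha, hgx b hb,
        ← hφf ⟨a, ha⟩]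
      exact Subgroup.mul_mem_sup (φ _).2 hb)
    refine ⟨hf.le.trans hb, hQ.trans hb, h₁.2 _ _ hφ, ψ, hψ, ⟨le_sup_left, fun x => ?_⟩,
      ⟨le_sup_right, fun x => ?_⟩⟩
    · rw [hψg, hφf]
      exact hgf x x.2
    · rw [hψg]
      exact hgx x x.2

/-- A morphism of one system extends by the identity on the other base group, so it fixes the
intersection. This extension lives in `F` only; saturation of each `Fᵢ` supplies extensions inside
`Fᵢ`. -/
theorem CentralizeEachOther.isCentralPair [Finite F.base] {h₁ : F₁ ≤ F} {h₂ : F₂ ≤ F}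
    (h : F.CentralizeEachOther F₁ F₂ h₁ h₂) (sat₁ : F₁.IsSaturated p)
    (sat₂ : F₂.IsSaturated p) : IsCentralPair F₁ F₂ := by
  have : Finite F₁.base := finite_of_le_base h₁.1
  have : Finite F₂.base := finite_of_le_base h₂.1
  obtain ⟨hc, hf₁⟩ := (le_centralizer_iff h₂.1 h₁).1 h.1
  obtain ⟨-, hf₂⟩ := (le_centralizer_iff h₁.1 h₂).1 h.2
  refine ⟨hc, sat₁.isCentral inf_le_left (fun z hz s hs => (hc s hs z hz.2).symm) ?_,
    sat₂.isCentral inf_le_left (fun z hz s hs => hc z hz.2 s hs) ?_⟩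
  · intro P f hf z hzP hz
    obtain ⟨g, -, hgf, hgz⟩ := hf₁ P f hf
    rw [← hgf z hzP, hgz z hz.2]
  · intro P f hf z hzP hz
    obtain ⟨g, -, hgf, hgz⟩ := hf₂ P f hf
    rw [← hgf z hzP, hgz z hz.2]

theorem IsCentralPair.centralProd_le (h : IsCentralPair F₁ F₂) {h₁ : F₁ ≤ F} {h₂ : F₂ ≤ F}
    (hc : F.CentralizeEachOther F₁ F₂ h₁ h₂) : h.centralProd ≤ F := by
  obtain ⟨-, hc₁⟩ := (le_centralizer_iff h₂.1 h₁).1 hc.1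
  obtain ⟨-, hc₂⟩ := (le_centralizer_iff h₁.1 h₂).1 hc.2
  refine le_iff_mor.2 ⟨sup_le h₁.1 h₂.1, fun P f hf => ?_⟩
  obtain ⟨hP, f₁, f₂, hf₁, hf₂, hfm⟩ := h.mor_centralProd.1 hf
  obtain ⟨g₁, hg₁, hgf₁, hgx₁⟩ := hc₁ _ f₁ hf₁
  obtain ⟨g₂, hg₂, hgf₂, hgx₂⟩ := hc₂ _ f₂ hf₂
  have key : ∀ x ∈ P, ∃ a ∈ h.proj P, ∃ b ∈ h.symm.proj P, a * b = x ∧ g₁ x = f₁ a * b := by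
    intro x hx
    obtain ⟨a, ha, b, hb, rfl⟩ := (h.mem_sup h.proj_le h.symm.proj_le).1 (h.le_proj_sup hP hx)
    refine ⟨a, ha, b, hb, rfl, ?_⟩
    rw [hg₁.map_mul (Subgroup.mem_sup_left ha) (Subgroup.mem_sup_right (h.symm.proj_le hb)),
      hgf₁ a ha, hgx₁ b (h.symm.proj_le hb)]
  -- First `a * b ↦ f₁ a * b`, then `f₁ a * b ↦ f₁ a * f₂ b`; both steps are morphisms of `F`.
  refine ((hg₁.mono ?_).comp ?_ hg₂).congr ?_
  · exact (h.le_proj_sup hP).trans (sup_le_sup_left h.symm.proj_le _)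
  · intro x hx
    obtain ⟨a, ha, b, hb, -, e⟩ := key x hx
    rw [e]
    exact mul_mem (Subgroup.mem_sup_right (hf₁.mem ha)) (Subgroup.mem_sup_left hb)
  · intro x hx
    obtain ⟨a, ha, b, hb, rfl, e⟩ := key x hx
    rw [e, hg₂.map_mul (Subgroup.mem_sup_right (hf₁.mem ha)) (Subgroup.mem_sup_left hb),
      hgx₂ _ (hf₁.mem ha), hgf₂ b hb, hfm a (h.proj_le ha) b (h.symm.proj_le hb) hx]

/-- A generator of `star` is the product of its restrictions to `P₁` and `P₂`. Conversely, a
morphism of `centralProd` on `P` is the restriction of a product map on the product of the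
projections, which is a generator because `hF` puts it in `F`. -/
theorem IsCentralPair.star_eq (h : IsCentralPair F₁ F₂) (hF : h.centralProd ≤ F) :
    F.star F₁ F₂ = h.centralProd := by
  refine ext_mor rfl fun P f => ⟨?_, fun hf => ?_⟩
  · rintro ⟨φ, ⟨-, -, -, hφ⟩, hφf⟩
    refine mor_of_mem (hφ h.centralProd rfl ?_) hφf
    rintro _ _ _ ⟨hP₁, hP₂, ψ, hψ, ⟨φ₁, hφ₁, i, hi⟩, ⟨φ₂, hφ₂, j, hj⟩⟩
    obtain ⟨g, hg, hψg⟩ := exists_mor hψ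
    obtain ⟨f₁, hf₁, e₁⟩ := exists_mor hφ₁
    obtain ⟨f₂, hf₂, e₂⟩ := exists_mor hφ₂
    refine (h.mor_centralProd_sup hf₁ hf₂ fun x hx y hy => ?_).mem_hom le_rfl ψ hψg
    rw [hg.map_mul (i hx) (j hy), ← e₁ ⟨x, hx⟩, ← e₂ ⟨y, hy⟩, ← hi, ← hj, hψg, hψg]
    rfl
  · obtain ⟨hP, f₁, f₂, hf₁, hf₂, hfm⟩ := h.mor_centralProd.1 hf
    obtain ⟨k, hk⟩ := h.exists_mul_apply hf₁ hf₂
    have hkm := h.mor_centralProd_sup hf₁ hf₂ hk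
    obtain ⟨ψ, hψ, hψk⟩ := id hkm
    obtain ⟨φ₁, hφ₁, e₁⟩ := id hf₁
    obtain ⟨φ₂, hφ₂, e₂⟩ := id hf₂
    have hψs : ψ ∈ (F.star F₁ F₂).Hom _ _ := by
      refine ⟨hkm.le, le_rfl, h.centralProd.injective hψ, fun E _ hC => hC _ _ ?_⟩
      refine .mk h.proj_le h.symm.proj_le ψ (hF.2 _ _ hψ) ⟨φ₁, hφ₁, le_sup_left, fun x => ?_⟩
        ⟨φ₂, hφ₂, le_sup_right, fun y => ?_⟩
      · have := hk x x.2 1 (one_mem _)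
        rw [mul_one, hf₂.map_one, mul_one] at this
        exact (hψk _).trans (this.trans (e₁ x).symm)
      · have := hk 1 (one_mem _) y y.2
        rw [one_mul, hf₁.map_one, one_mul] at this
        exact (hψk _).trans (this.trans (e₂ y).symm)
    refine ((mor_of_mem hψs hψk).mono (h.le_proj_sup hP)).congr fun x hx => ?_
    obtain ⟨a, ha, b, hb, rfl⟩ := (h.mem_sup h.proj_le h.symm.proj_le).1 (h.le_proj_sup hP hx)
    rw [hk a ha b hb, hfm a (h.proj_le ha) b (h.symm.proj_le hb) hx]

theorem mem_imageSubgroup {G' : Type*} [Group G'] {S : Subgroup G} {S' : Subgroup G'}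
    {α : S →* S'} {P : Subgroup G} {y : G'} :
    y ∈ imageSubgroup α P ↔ ∃ (x : G) (hx : x ∈ S), x ∈ P ∧ (α ⟨x, hx⟩ : G') = y := by
  constructor
  · rintro ⟨_, ⟨⟨x, hx⟩, hxP, rfl⟩, rfl⟩
    exact ⟨x, hx, hxP, rfl⟩
  · rintro ⟨x, hx, hxP, rfl⟩
    exact ⟨_, ⟨⟨x, hx⟩, hxP, rfl⟩, rfl⟩

/-- If `α` is a left inverse of an embedding `ι` on the base group of `F`, then `F` is the image
under `α` of its image under `ι`. -/
theorem isImage_map {G' : Type*} [Group G'] {ι : G →* G'} (hι : Function.Injective ι)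
    {S : Subgroup G'} {S' : Subgroup G} (α : S →* S') (hS : ∀ x ∈ F.base, ι x ∈ S)
    (hα : ∀ (x : G) (hx : ι x ∈ S), (α ⟨ι x, hx⟩ : G) = x) : IsImage α (F.map ι hι) F := by
  have himg : ∀ P ≤ F.base, imageSubgroup α (P.map ι) = P := by
    intro P hP
    ext y
    rw [mem_imageSubgroup]
    constructor
    · rintro ⟨_, hx, ⟨x, hxP, rfl⟩, rfl⟩
      rwa [hα]
    · intro hy
      exact ⟨ι y, hS y (hP hy), ⟨y, hy, rfl⟩, hα _ _⟩
  refine ⟨?_, (himg _ le_rfl).symm, fun P' Q' ψ => ⟨fun hψ => ?_, ?_⟩⟩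
  · rintro _ ⟨x, hx, rfl⟩
    exact hS x hx
  · let eP := P'.equivMapOfInjective ι hι
    let eQ := Q'.equivMapOfInjective ι hι
    have key : ∀ (x : P') (hx : ι x ∈ P'.map ι),
        (((eQ.toMonoidHom.comp ψ).comp eP.symm.toMonoidHom) ⟨ι x, hx⟩ : G') = ι (ψ x) := by
      intro x hx
      have : (⟨ι x, hx⟩ : ↥(P'.map ι)) = eP x := Subtype.ext rfl
      rw [this]
      simp [eQ]
    refine ⟨P'.map ι, Q'.map ι, (eQ.toMonoidHom.comp ψ).comp eP.symm.toMonoidHom,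
      ⟨P', Q', ψ, hψ, rfl, rfl, key⟩, (himg _ (F.dom_le hψ)).symm, (himg _ (F.cod_le hψ)).symm, ?_⟩
    rintro ⟨_, x, hx, rfl⟩ hxS hφx hxP
    have e1 : (⟨(α ⟨ι x, hxS⟩ : G), hxP⟩ : P') = ⟨x, hx⟩ := Subtype.ext (hα x hxS)
    have e2 : (⟨(((eQ.toMonoidHom.comp ψ).comp eP.symm.toMonoidHom) ⟨ι x, ⟨x, hx, rfl⟩⟩ : G'),
        hφx⟩ : S) = ⟨ι (ψ ⟨x, hx⟩), hS _ (F.cod_le hψ (ψ _).2)⟩ :=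
      Subtype.ext (key ⟨x, hx⟩ ⟨x, hx, rfl⟩)
    rw [e1]
    exact ((congrArg (fun y => (α y : G)) e2).trans (hα _ _)).symm
  · rintro ⟨_, _, φ, ⟨P, Q, φ₀, hφ₀, rfl, rfl, hφ⟩, hP', hQ', hint⟩
    rw [himg _ (F.dom_le hφ₀)] at hP'
    rw [himg _ (F.cod_le hφ₀)] at hQ'
    subst hP' hQ'
    refine F.mem_of_eq hφ₀ rfl rfl ψ fun x hx _ => ?_
    have hxS := hS x (F.dom_le hφ₀ hx)
    have hφx := hφ ⟨x, hx⟩ ⟨x, hx, rfl⟩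
    have hyS : ι (φ₀ ⟨x, hx⟩) ∈ S := hS _ (F.cod_le hφ₀ (φ₀ _).2)
    have := hint ⟨ι x, ⟨x, hx, rfl⟩⟩ hxS (by rw [hφx]; exact hyS) (by rw [hα]; exact hx)
    have e1 : (⟨(α ⟨ι x, hxS⟩ : G), by rw [hα]; exact hx⟩ : P') = ⟨x, hx⟩ :=
      Subtype.ext (hα x hxS)
    rw [e1] at this
    rw [this]
    refine Eq.trans (congrArg (fun y : S => (α y : G)) (Subtype.ext hφx)) (hα _ hyS)

theorem IsCentralPair.isCentralProduct (h : IsCentralPair F₁ F₂) :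
    h.centralProd.IsCentralProduct F₁ F₂ := by
  have hmem : ∀ x : ↥(F₁.base.prod F₂.base), x.1.1 * x.1.2 ∈ F₁.base ⊔ F₂.base := fun x =>
    Subgroup.mul_mem_sup x.2.1 x.2.2
  let α : (F₁.prod F₂).base →* h.centralProd.base :=
    MonoidHom.mk' (fun x : ↥(F₁.base.prod F₂.base) =>
      (⟨x.1.1 * x.1.2, hmem x⟩ : ↥(F₁.base ⊔ F₂.base)))
      fun x y => Subtype.ext (h.mul_mul_mul_comm x.2.2 y.2.1).symm
  have hα : ∀ x : (F₁.prod F₂).base, (α x : G) = (x : G × G).1 * (x : G × G).2 := fun _ => rfl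
  refine ⟨h.left_le_centralProd, h.right_le_centralProd, le_sSup h.left, ?_,
    α, hα, ⟨?_, ?_, ?_⟩, ?_, ?_⟩
  · rw [inf_comm]
    exact le_sSup h.right
  · intro P Q φ hφ
    obtain ⟨f, hf, hφf⟩ := exists_mor hφ
    obtain ⟨f₁, f₂, hf₁, hf₂, hfm⟩ := mor_prod.1 hf
    obtain ⟨k, hk⟩ := h.exists_mul_apply hf₁ hf₂
    have hφk : ∀ x : P, k ((x : G × G).1 * (x : G × G).2) =
        (φ x : G × G).1 * (φ x : G × G).2 := fun x => by
      rw [hφf, hfm x x.2, hk _ (fst_mem_map x.2) _ (snd_mem_map x.2)]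
    have hPk : imageSubgroup α P ≤
        P.map (MonoidHom.fst G G) ⊔ P.map (MonoidHom.snd G G) := by
      intro y hy
      obtain ⟨x, hx, hxP, rfl⟩ := mem_imageSubgroup.1 hy
      exact Subgroup.mul_mem_sup (fst_mem_map hxP) (snd_mem_map hxP)
    obtain ⟨ψ, hψ, hψk⟩ := ((h.mor_centralProd_sup hf₁ hf₂ hk).mono hPk).exists_hom
      (Q := imageSubgroup α Q) (Subgroup.map_subtype_le _) (by
        intro y hy
        obtain ⟨x, hx, hxP, rfl⟩ := mem_imageSubgroup.1 hy
        rw [hα, hφk ⟨x, hxP⟩]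
        exact mem_imageSubgroup.2 ⟨_, (F₁.prod F₂).cod_le hφ (φ ⟨x, hxP⟩).2, (φ _).2, rfl⟩)
    refine ⟨ψ, hψ, fun x hx hφx hy => ?_⟩
    rw [hψk, hα, hα, hφk]
  · rintro ⟨y, hy⟩
    obtain ⟨a, ha, b, hb, rfl⟩ := (h.mem_sup le_rfl le_rfl).1 hy
    exact ⟨⟨(a, b), ha, hb⟩, rfl⟩
  · intro P Q hP hQ _ hkQ ψ hψ
    obtain ⟨f, hf, hψf⟩ := exists_mor hψ
    obtain ⟨-, f₁, f₂, hf₁, hf₂, hfm⟩ := h.mor_centralProd.1 hf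
    have hmem : ∀ x ∈ P, x.1 ∈ F₁.base ∧ x.2 ∈ F₂.base ∧ x.1 * x.2 ∈ imageSubgroup α P :=
      fun x hx => ⟨(hP hx).1, (hP hx).2, mem_imageSubgroup.2 ⟨x, hP hx, hx, rfl⟩⟩
    have hfst : P.map (MonoidHom.fst G G) ≤ h.proj (imageSubgroup α P) := by
      rintro _ ⟨x, hx, rfl⟩
      obtain ⟨a, b, c⟩ := hmem x hx
      exact ⟨a, x.2, b, c⟩
    have hsnd : P.map (MonoidHom.snd G G) ≤ h.symm.proj (imageSubgroup α P) := by
      rintro _ ⟨x, hx, rfl⟩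
      obtain ⟨a, b, c⟩ := hmem x hx
      exact h.mem_proj_symm.2 ⟨b, x.1, a, c⟩
    have hψm : ∀ x (hx : x ∈ P), (ψ ⟨x.1 * x.2, (hmem x hx).2.2⟩ : G) = f₁ x.1 * f₂ x.2 := by
      intro x hx
      obtain ⟨a, b, c⟩ := hmem x hx
      rw [hψf, hfm _ a _ b c]
    -- The lift of `ψ` is the product of its components, restricted to `P`.
    have hmor : (F₁.prod F₂).Mor P (fun x => (f₁ x.1, f₂ x.2)) :=
      mor_prod.2 ⟨f₁, f₂, hf₁.mono hfst, hf₂.mono hsnd, fun _ _ => rfl⟩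
    obtain ⟨φ, hφ, hφf⟩ := hmor.exists_hom hQ (by
      intro x hx
      have hq := (ψ ⟨x.1 * x.2, (hmem x hx).2.2⟩).2
      rw [hψm x hx] at hq
      obtain ⟨q, hqS, hqQ, hqe⟩ := mem_imageSubgroup.1 hq
      have hfS : (f₁ x.1, f₂ x.2) ∈ (F₁.prod F₂).base := hmor.mem hx
      -- The lifted value has the same product as some `q ∈ Q`; as `Q` contains the kernel of `α`,
      -- the value itself lies in `Q`.
      have hker : (⟨q, hqS⟩ : (F₁.prod F₂).base)⁻¹ * ⟨_, hfS⟩ ∈ α.ker := by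
        rw [MonoidHom.mem_ker, map_mul, map_inv, inv_mul_eq_one]
        exact Subtype.ext hqe
      have := mul_mem hqQ (hkQ ⟨_, hker, rfl⟩)
      simpa using this)
    refine ⟨φ, hφ, fun x hx hφx hy => ?_⟩
    have e : (⟨φ x, hφx⟩ : (F₁.prod F₂).base) = ⟨(f₁ x.1.1, f₂ x.1.2), hφf x ▸ hφx⟩ :=
      Subtype.ext (hφf x)
    rw [e]
    exact hψm x x.2
  · exact isImage_map _ α (fun x hx => ⟨hx, one_mem _⟩) fun x hx => by rw [hα]; simp
  · exact isImage_map _ α (fun x hx => ⟨one_mem _, hx⟩) fun x hx => by rw [hα]; simp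

theorem IsCentralProduct.centralizeEachOther (h : D.IsCentralProduct F₁ F₂) (hD : D ≤ F)
    (h₁ : F₁ ≤ F) (h₂ : F₂ ≤ F) : F.CentralizeEachOther F₁ F₂ h₁ h₂ := by
  obtain ⟨α, hα, ⟨hmor, -, -⟩, -, -⟩ := h.exists_mul
  -- Multiplicativity of `α` on `(1, y) * (x, 1)` is exactly this commutation.
  have hcomm : ∀ x ∈ F₁.base, ∀ y ∈ F₂.base, x * y = y * x := by
    intro x hx y hy
    let u : (F₁.prod F₂).base := ⟨(1, y), one_mem _, hy⟩
    let v : (F₁.prod F₂).base := ⟨(x, 1), hx, one_mem _⟩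
    have h1 : (α (u * v) : G) = α u * α v := congrArg Subtype.val (α.map_mul u v)
    rw [hα, hα, hα] at h1
    simpa [u, v] using h1
  have key : ∀ P f, (F₁.prod F₂).Mor P f → ∃ g, F.Mor (imageSubgroup α P) g ∧
      ∀ x ∈ P, g (x.1 * x.2) = (f x).1 * (f x).2 := by
    rintro P f ⟨φ, hφ, hφf⟩
    obtain ⟨ψ, hψ, hint⟩ := hmor P _ φ hφ
    obtain ⟨g, hg, hψg⟩ := exists_mor (hD.2 _ _ hψ)
    refine ⟨g, hg, fun x hx => ?_⟩
    have hxS := (F₁.prod F₂).dom_le hφ hx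
    have := hint ⟨x, hx⟩ hxS (φ _).2 (mem_imageSubgroup.2 ⟨x, hxS, hx, rfl⟩)
    rw [hψg, hα, hα] at this
    rw [this, hφf]
  constructor
  · refine (le_centralizer_iff h₂.1 h₁).2 ⟨hcomm, fun P f hf => ?_⟩
    -- The image of `f × id` under multiplication extends `f` and is the identity on `S₂`.
    obtain ⟨g, hg, hgf⟩ := key (P.prod F₂.base) (fun x => (f x.1, x.2))
      (mor_prod.2 ⟨f, fun x => x, hf.mono (by rintro _ ⟨x, hx, rfl⟩; exact hx.1),
        .id (by rintro _ ⟨x, hx, rfl⟩; exact hx.2), fun _ _ => rfl⟩)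
    have h1 : ∀ x ∈ P, (x, (1 : G)) ∈ P.prod F₂.base := fun x hx => ⟨hx, one_mem _⟩
    have h2 : ∀ y ∈ F₂.base, ((1 : G), y) ∈ P.prod F₂.base := fun y hy => ⟨one_mem _, hy⟩
    refine ⟨g, hg.mono (sup_le (fun x hx => ?_) fun y hy => ?_), fun x hx => ?_, fun y hy => ?_⟩
    · exact mem_imageSubgroup.2 ⟨_, ⟨hf.le hx, one_mem _⟩, h1 x hx, by rw [hα]; simp⟩
    · exact mem_imageSubgroup.2 ⟨_, ⟨one_mem _, hy⟩, h2 y hy, by rw [hα]; simp⟩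
    · simpa using hgf _ (h1 x hx)
    · simpa [hf.map_one] using hgf _ (h2 y hy)
  · refine (le_centralizer_iff h₁.1 h₂).2
      ⟨fun y hy x hx => (hcomm x hx y hy).symm, fun P f hf => ?_⟩
    obtain ⟨g, hg, hgf⟩ := key (F₁.base.prod P) (fun x => (x.1, f x.2))
      (mor_prod.2 ⟨fun x => x, f, .id (by rintro _ ⟨x, hx, rfl⟩; exact hx.1),
        hf.mono (by rintro _ ⟨x, hx, rfl⟩; exact hx.2), fun _ _ => rfl⟩)
    have h1 : ∀ x ∈ F₁.base, (x, (1 : G)) ∈ F₁.base.prod P := fun x hx => ⟨hx, one_mem _⟩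
    have h2 : ∀ y ∈ P, ((1 : G), y) ∈ F₁.base.prod P := fun y hy => ⟨one_mem _, hy⟩
    refine ⟨g, hg.mono (sup_le (fun y hy => ?_) fun x hx => ?_), fun y hy => ?_, fun x hx => ?_⟩
    · exact mem_imageSubgroup.2 ⟨_, ⟨one_mem _, hf.le hy⟩, h2 y hy, by rw [hα]; simp⟩
    · exact mem_imageSubgroup.2 ⟨_, ⟨hx, one_mem _⟩, h1 x hx, by rw [hα]; simp⟩
    · simpa using hgf _ (h2 y hy)
    · simpa [hf.map_one] using hgf _ (h1 x hx)

end CentralProductCharacterization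

end FusionSystem

theorem mainTheorem5 {p : ℕ} [Fact p.Prime] {G : Type*} [Group G]
    (F F₁ F₂ : FusionSystem G) [Finite F.base] (hS : IsPGroup p F.base)
    (h₁ : F₁ ≤ F) (h₂ : F₂ ≤ F) (sat₁ : F₁.IsSaturated p) (sat₂ : F₂.IsSaturated p) :
    (F.CentralizeEachOther F₁ F₂ h₁ h₂ ↔ ∃ D ≤ F, D.IsCentralProduct F₁ F₂) ∧
    (F.CentralizeEachOther F₁ F₂ h₁ h₂ →
      F.star F₁ F₂ ≤ F ∧ (F.star F₁ F₂).IsCentralProduct F₁ F₂ ∧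
        (F.star F₁ F₂).IsSaturated p) := by
  have : Finite F₁.base := FusionSystem.finite_of_le_base h₁.1
  have : Finite F₂.base := FusionSystem.finite_of_le_base h₂.1
  have key : F.CentralizeEachOther F₁ F₂ h₁ h₂ →
      F.star F₁ F₂ ≤ F ∧ (F.star F₁ F₂).IsCentralProduct F₁ F₂ ∧
        (F.star F₁ F₂).IsSaturated p := by
    intro hc
    have h := hc.isCentralPair sat₁ sat₂
    have hF := h.centralProd_le hc
    rw [h.star_eq hF]
    exact ⟨hF, h.isCentralProduct, h.isSaturated_centralProd (hS.to_le hF.1) sat₁ sat₂⟩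
  refine ⟨⟨fun hc => ⟨_, (key hc).1, (key hc).2.1⟩, ?_⟩, key⟩
  rintro ⟨D, hD, h⟩
  exact h.centralizeEachOther hD h₁ h₂
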